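/- Let $T,k,d,p,d'\ge 1$ be integers with $k\mid T$. Let $W_{0:T-1}\sim N(0,I_{pT})$ and let $\mathbf L\in\mathbb R^{dT\times pT}$ be block lower triangular with respect to its partition into blocks $\mathbf L_{ij}\in\mathbb R^{dk\times pk}$, $1\le i,j\le T/k$ (that is, $\mathbf L_{ij}=0$ for $i<j$). Let $X_{0:T-1}=(X_0^{\mathsf T},\dots,X_{T-1}^{\mathsf T})^{\mathsf T}=\mathbf L W_{0:T-1}$ be the corresponding $k$-causal Gaussian process in $\mathbb R^d$, and let $\tilde X_{0:T-1}=\mathrm{blkdiag}(\mathbf L_{1,1},\dots,\mathbf L_{T/k,T/k})\,W_{0:T-1}$ be the associated decoupled process. Put $$\psi_k=\inf_{\Delta\in\mathbb R^{d'\times d}\setminus\{0\}}\frac{\Big(\sum_{j=1}^{T/k}\operatorname{tr} Q_j(\Delta)\Big)^2}{T\sum_{j=1}^{T/k}\operatorname{tr}\big(Q_j(\Delta)^2\big)},\qquad Q_j(\Delta)=\mathbf L_{j,j}^{\mathsf T}\,\mathrm{blkdiag}(\Delta^{\mathsf T}\Delta,\dots,\Delta^{\mathsf T}\Delta)\,\mathbf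 L_{j,j},$$ where the block-diagonal matrix has $k$ copies of $\Delta^{\mathsf T}\Delta$ (the case of main interest is $d'=1$). Write $\lambda_{\min},\lambda_{\max}$ for the smallest and the largest eigenvalue of a symmetric matrix. If $\lambda_{\min}\big(\sum_{t=0}^{T-1}\mathbf E\tilde X_t\tilde X_t^{\mathsf T}\big)>0$, then $$\mathbf P\left(\lambda_{\min}\Big(\frac1T\sum_{t=0}^{T-1}X_tX_t^{\mathsf T}\Big)\le\lambda_{\min}\Big(\frac1{8T}\sum_{t=0}^{T-1}\mathbf E\tilde X_t\tilde X_t^{\mathsf T}\Big)\right)$$ $$\le\left(16\sqrt{1+\frac{\psi_k T\,\lambda_{\max}\big(\mathbf E[X_{0:T-1}X_{0:T-1}^{\mathsf T}]\big)}{\lambda_{\min}\big(\sum_{t=0}^{T-1}\mathbf E[X_tX_t^{\mathsf T}]\big)}}\;\sqrt{\frac{\lambda_{\max}\big(\sum_{t=0}^{T-1}\mathbf E X_tX_t^{\mathsf T}\big)}{\lambda_{\min}\big(\sum_{t=0}^{T-1}\mathbf E\tilde X_t\tilde X_t^{\mathsf T}\big)}}\right)^{d}\exp\left(\frac{-\psi_kT}{8}\right).$$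 -/

import Mathlib

open MeasureTheory ProbabilityTheory
open scoped Matrix Kronecker

noncomputable section

namespace CausalGaussian

/-- The smallest eigenvalue of a real symmetric matrix. -/
def lambdaMin {n : Type*} [Fintype n] [DecidableEq n] (M : Matrix n n ℝ) : ℝ :=
  sInf (spectrum ℝ M)

/-- The largest eigenvalue of a real symmetric matrix. -/
def lambdaMax {n : Type*} [Fintype n] [DecidableEq n] (M : Matrix n n ℝ) : ℝ :=
  sSup (spectrum ℝ M)

/-- The second moment matrix `E [x xᵀ]` of a random vector `x`, entry by entry. -/
def secondMoment {Ω n : Type*} [MeasurableSpace Ω] (P : Measure Ω) (x : Ω → n → ℝ) :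
    Matrix n n ℝ :=
  Matrix.of fun i j => ∫ ω, x ω i * x ω j ∂P

/-- The stacked random vector `X_{0:T-1}` of a process `X_0, …, X_{T-1}` in `ℝᵈ`. -/
def stack {Ω : Type*} {T d : ℕ} (X : Fin T → Ω → Fin d → ℝ) : Ω → Fin T × Fin d → ℝ :=
  fun ω s => X s.1 ω s.2

/-- The process `X_0, …, X_{T-1}` whose stacked vector is `L W`. -/
def linearProcess {Ω : Type*} {T d p : ℕ} (L : Matrix (Fin T × Fin d) (Fin T × Fin p) ℝ)
    (W : Ω → EuclideanSpace ℝ (Fin T × Fin p)) : Fin T → Ω → Fin d → ℝ :=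
  fun t ω i => (L *ᵥ (W ω).ofLp) (t, i)

/-- The time `j k + a`: the `a`-th time point (from `0`) of the `j`-th block (from `0`) of
length `k`. -/
def blockTime {T k : ℕ} (j : Fin (T / k)) (a : Fin k) : Fin T :=
  ⟨j * k + a, by
    have h1 : ((j : ℕ) + 1) * k ≤ T / k * k := Nat.mul_le_mul_right k j.isLt
    have h2 : T / k * k ≤ T := Nat.div_mul_le_self T k
    have h3 : (a : ℕ) < k := a.isLt
    rw [Nat.add_mul, Nat.one_mul] at h1
    omega⟩

/-- The block `L_{ij}` (of size `dk × pk`) of `L`, when time is cut into blocks of length `k`. -/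
def block {T d p : ℕ} (k : ℕ) (L : Matrix (Fin T × Fin d) (Fin T × Fin p) ℝ)
    (i j : Fin (T / k)) : Matrix (Fin k × Fin d) (Fin k × Fin p) ℝ :=
  L.submatrix (fun s => (blockTime i s.1, s.2)) (fun s => (blockTime j s.1, s.2))

/-- The matrix `blkdiag(L_{11}, …, L_{T/k,T/k})`: the entries of `L` between two times of the
same block are kept, all others are set to zero. -/
def blockDiagPart {T d p : ℕ} (k : ℕ) (L : Matrix (Fin T × Fin d) (Fin T × Fin p) ℝ) :
    Matrix (Fin T × Fin d) (Fin T × Fin p) ℝ :=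
  Matrix.of fun s t => if (s.1 : ℕ) / k = (t.1 : ℕ) / k then L s t else 0

/-- `X_{0:T-1}` is the `k`-causal Gaussian process `L W` driven by the white noise `W`:
`k` divides `T`, `W ∼ N(0, I_{pT})`, `X_{0:T-1} = L W` almost surely, and `L` is block lower
triangular with respect to blocks of length `k`. -/
structure IsCausalGaussian {Ω : Type*} [MeasurableSpace Ω] (P : Measure Ω) {T d p : ℕ} (k : ℕ)
    (L : Matrix (Fin T × Fin d) (Fin T × Fin p) ℝ)
    (W : Ω → EuclideanSpace ℝ (Fin T × Fin p)) (X : Fin T → Ω → Fin d → ℝ) : Prop where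
  pos : 0 < k
  dvd : k ∣ T
  law : HasLaw W (stdGaussian (EuclideanSpace ℝ (Fin T × Fin p))) P
  eq : ∀ᵐ ω ∂P, ∀ t, X t ω = linearProcess L W t ω
  causal : ∀ i j : Fin (T / k), i < j → block k L i j = 0

/-- The decoupled process `X̃_{0:T-1} = blkdiag(L_{11}, …, L_{T/k,T/k}) W_{0:T-1}`. -/
def decoupled {Ω : Type*} {T d p : ℕ} (k : ℕ) (L : Matrix (Fin T × Fin d) (Fin T × Fin p) ℝ)
    (W : Ω → EuclideanSpace ℝ (Fin T × Fin p)) : Fin T → Ω → Fin d → ℝ :=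
  linearProcess (blockDiagPart k L) W

/-- The matrix `L_{jj}ᵀ blkdiag(Δᵀ Δ) L_{jj}`, with `k` copies of `Δᵀ Δ` on the diagonal. -/
def blockGram {T d p d' : ℕ} (k : ℕ) (L : Matrix (Fin T × Fin d) (Fin T × Fin p) ℝ)
    (Δ : Matrix (Fin d') (Fin d) ℝ) (j : Fin (T / k)) :
    Matrix (Fin k × Fin p) (Fin k × Fin p) ℝ :=
  (block k L j j)ᵀ * ((1 : Matrix (Fin k) (Fin k) ℝ) ⊗ₖ (Δᵀ * Δ)) * block k L j j

/-- The parameter `ψ_k`, an infimum over the nonzero `d' × d` matrices `Δ`. -/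
def psi {T d p : ℕ} (k d' : ℕ) (L : Matrix (Fin T × Fin d) (Fin T × Fin p) ℝ) : ℝ :=
  ⨅ Δ : {Δ : Matrix (Fin d') (Fin d) ℝ // Δ ≠ 0},
    (∑ j : Fin (T / k), (blockGram k L Δ.1 j).trace) ^ 2 /
      ((T : ℝ) * ∑ j : Fin (T / k), (blockGram k L Δ.1 j ^ 2).trace)

end CausalGaussian

end

noncomputable section

namespace CausalGaussian

/-! Fix a unit vector u, choose Δ with ΔᵀΔ = uuᵀ, and let S and V be the sums over j of tr Q_j(Δ)
and tr Q_j(Δ)². Once the noise of all other blocks is fixed, the j-th block of ⟨u, X_t⟩ has the form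
D w + m with w standard Gaussian, and E exp(-s|D w + m|²) ≤ exp(-s tr(DᵀD) + s² tr((DᵀD)²)) whatever
the offset m is (`lintegral_exp_neg_sq_le`). Integrating out the blocks from the last to the first
therefore erases the dependence on the past: E exp(-s ∑ ⟨u, X_t⟩²) ≤ exp(-sS + s²V)
(`lintegral_exp_neg_causal_le`). Here S is the decoupled energy in direction u and S²/V ≥ ψT, so
Chernoff's bound shows that the energy falls to S/4 with probability at most exp(-(9/64)ψT)
(`measure_energy_le`).

Uniformity in u comes from nets on the sphere, which require a bound on the largest eigenvalue of
the empirical matrix. Let m and M be the extreme eigenvalues of ∑ E X_t X_tᵀ, m' the smallest one of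
the decoupled sum, Λ the largest one of the covariance of the stacked vector, and q = 1 + ψTΛ/m. In
a fixed direction the energy exceeds (3/2)qM with probability at most exp(-(3/8)ψT)
(`measure_le_energy`), and a net of mesh 1/8 turns this into a bound on the largest eigenvalue. With
R² = qM/m', a second net of mesh 1/(10R) then has discretization error a small multiple of m'
(`exists_net_quadForm_le`).

The nets have at most 17^d and (1 + 20R)^d points. Both rates, 3/8 and 9/64, exceed 1/8, and this
surplus brings the union bound down to (16R)^d exp(-ψT/8) whenever that quantity is at most 1
(`net_count_bound`); otherwise there is nothing to prove. -/

/-- The standard Gaussian measure on `ι → ℝ`, as a product measure. -/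
def gaussianPi (ι : Type*) [Fintype ι] : Measure (ι → ℝ) :=
  Measure.pi fun _ => gaussianReal 0 1

instance {ι : Type*} [Fintype ι] : IsProbabilityMeasure (gaussianPi ι) := by
  unfold gaussianPi; infer_instance

/-! ### One-dimensional Gaussian integrals and scalar estimates. -/

lemma integral_exp_neg_mul_sq_gaussianReal {t : ℝ} (ht : -(1 / 2) < t) (a : ℝ) :
    Integrable (fun z : ℝ => Real.exp (-t * (z + a) ^ 2)) (gaussianReal 0 1) ∧
      ∫ z, Real.exp (-t * (z + a) ^ 2) ∂(gaussianReal 0 1) =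
        (√(1 + 2 * t))⁻¹ * Real.exp (-t * a ^ 2 / (1 + 2 * t)) := by
  have h2 : 0 < 1 + 2 * t := by linarith
  -- Completing the square: t(z + a)² + z²/2 = (t + 1/2)(z + 2ta/(1 + 2t))² + ta²/(1 + 2t).
  have key : ∀ z : ℝ, gaussianPDFReal 0 1 z * Real.exp (-t * (z + a) ^ 2) =
      ((√(2 * Real.pi))⁻¹ * Real.exp (-t * a ^ 2 / (1 + 2 * t))) *
        Real.exp (-(t + 1 / 2) * (z + 2 * t * a / (1 + 2 * t)) ^ 2) := by
    intro z
    simp only [gaussianPDFReal, NNReal.coe_one, mul_one, sub_zero]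
    rw [mul_assoc, mul_assoc, ← Real.exp_add, ← Real.exp_add]
    congr 2
    field_simp
    ring
  have hint : Integrable (fun z : ℝ => gaussianPDFReal 0 1 z * Real.exp (-t * (z + a) ^ 2)) := by
    simp_rw [key]
    exact ((integrable_exp_neg_mul_sq (b := t + 1 / 2) (by linarith)).comp_add_right
      (2 * t * a / (1 + 2 * t))).const_mul _
  constructor
  · rw [gaussianReal_of_var_ne_zero 0 one_ne_zero,
      integrable_withDensity_iff (measurable_gaussianPDF 0 1) (by simp [gaussianPDF])]
    refine hint.congr (ae_of_all _ fun z => ?_)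
    simp only [gaussianPDF]
    rw [ENNReal.toReal_ofReal (gaussianPDFReal_nonneg 0 1 z), mul_comm]
  · rw [integral_gaussianReal_eq_integral_smul one_ne_zero]
    simp_rw [smul_eq_mul, key]
    rw [integral_const_mul,
      integral_add_right_eq_self (fun z : ℝ => Real.exp (-(t + 1 / 2) * z ^ 2)) _,
      integral_gaussian, mul_right_comm]
    congr 1
    rw [← Real.sqrt_inv, ← Real.sqrt_mul (by positivity), ← Real.sqrt_inv]
    congr 1
    have h3 : t + 1 / 2 = (1 + 2 * t) / 2 := by ring
    have := Real.pi_pos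
    rw [h3]
    field_simp

/-- After taking logarithms this follows from log(1 + x) ≥ 2x/(x + 2) at x = 2t. -/
lemma inv_sqrt_one_add_le {t : ℝ} (ht : 0 ≤ t) :
    (√(1 + 2 * t))⁻¹ ≤ Real.exp (-t + t ^ 2) := by
  rw [inv_le_comm₀ (by positivity) (by positivity), ← Real.exp_neg]
  apply Real.le_sqrt_of_sq_le
  rw [← Real.exp_nat_mul, ← Real.le_log_iff_exp_le (by positivity)]
  have h := Real.le_log_one_add_of_nonneg (x := 2 * t) (by positivity)
  refine le_trans ?_ h
  rw [le_div_iff₀ (by positivity)]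
  push_cast
  nlinarith [pow_nonneg ht 3]

lemma inv_sqrt_one_sub_le {x : ℝ} (h0 : 0 ≤ x) (h1 : x ≤ 1 / 4) :
    (√(1 - 2 * x))⁻¹ ≤ Real.exp (3 / 2 * x) := by
  have h2 : 0 < 1 - 2 * x := by linarith
  rw [inv_le_comm₀ (by positivity) (by positivity), ← Real.exp_neg]
  apply Real.le_sqrt_of_sq_le
  rw [← Real.exp_nat_mul, show ((2 : ℕ) : ℝ) * -(3 / 2 * x) = -(3 * x) by push_cast; ring,
    Real.exp_neg, inv_le_comm₀ (by positivity) h2]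
  refine le_trans ?_ (Real.quadratic_le_exp_of_nonneg (x := 3 * x) (by positivity))
  rw [inv_le_iff_one_le_mul₀' h2]
  nlinarith [mul_nonneg h0 (sub_nonneg.2 h1), mul_nonneg (mul_nonneg h0 h0) (sub_nonneg.2 h1)]

/-! ### Laplace transforms of Gaussian quadratic forms. -/

section GaussianIntegrals

variable {ι κ : Type*} [Fintype ι] [Fintype κ]

lemma lintegral_exp_neg_sum_mul_sq (t a : ι → ℝ) (ht : ∀ i, -(1 / 2) < t i) :
    ∫⁻ z, ENNReal.ofReal (Real.exp (-∑ i, t i * (z i + a i) ^ 2)) ∂(gaussianPi ι) =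
      ENNReal.ofReal (∏ i, ((√(1 + 2 * t i))⁻¹ * Real.exp (-t i * a i ^ 2 / (1 + 2 * t i)))) := by
  have h1 : ∀ z : ι → ℝ, Real.exp (-∑ i, t i * (z i + a i) ^ 2) =
      ∏ i, Real.exp (-t i * (z i + a i) ^ 2) := by
    intro z
    rw [← Real.exp_sum, ← Finset.sum_neg_distrib]
    simp
  simp_rw [h1]
  rw [← ofReal_integral_eq_lintegral_ofReal]
  · rw [gaussianPi, integral_fintype_prod_eq_prod
      (f := fun i x => Real.exp (-t i * (x + a i) ^ 2))]
    simp_rw [fun i => (integral_exp_neg_mul_sq_gaussianReal (ht i) (a i)).2]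
  · exact Integrable.fintype_prod_dep (f := fun i x => Real.exp (-t i * (x + a i) ^ 2))
      fun i => (integral_exp_neg_mul_sq_gaussianReal (ht i) (a i)).1
  · exact ae_of_all _ fun z => Finset.prod_nonneg fun i _ => (Real.exp_pos _).le

lemma mulVec_dotProduct_mulVec_self (E : Matrix κ ι ℝ) (y : ι → ℝ) :
    (E *ᵥ y) ⬝ᵥ (E *ᵥ y) = y ⬝ᵥ (Eᵀ * E) *ᵥ y := by
  rw [← Matrix.mulVec_mulVec, Matrix.mulVec_transpose, dotProduct_comm y,
    ← Matrix.dotProduct_mulVec]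

lemma isHermitian_gram {ι κ : Type*} [Fintype κ] (D : Matrix κ ι ℝ) : (Dᵀ * D).IsHermitian := by
  rw [Matrix.IsHermitian, Matrix.conjTranspose_eq_transpose_of_trivial]
  simp

variable [DecidableEq ι]

/-- Rotation invariance of the standard Gaussian; it permits working in an eigenbasis, where the
quadratic forms split into independent coordinates. -/
lemma measurePreserving_eigenvectorUnitary {A : Matrix ι ι ℝ} (hA : A.IsHermitian) :
    MeasurePreserving (fun x => (hA.eigenvectorUnitary : Matrix ι ι ℝ) *ᵥ x)
      (gaussianPi ι) (gaussianPi ι) := by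
  have hmeas : Measurable fun x : ι → ℝ => (hA.eigenvectorUnitary : Matrix ι ι ℝ) *ᵥ x :=
    (Continuous.matrix_mulVec continuous_const continuous_id).measurable
  refine ⟨hmeas, ?_⟩
  have h1 := stdGaussian_eq_map_pi_orthonormalBasis hA.eigenvectorBasis
  have h2 := map_pi_eq_stdGaussian (ι := ι)
  have h3 := congrArg (Measure.map (fun x : EuclideanSpace ℝ ι => x.ofLp)) (h2.trans h1)
  rw [Measure.map_map (by fun_prop) (by fun_prop), Measure.map_map (by fun_prop)
    (Finset.measurable_sum _ (by fun_prop))] at h3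
  rw [show (fun x : EuclideanSpace ℝ ι => x.ofLp) ∘ WithLp.toLp 2 = id from rfl,
    Measure.map_id] at h3
  rw [gaussianPi]
  nth_rw 2 [h3]
  congr 1
  ext x i
  simp [Matrix.mulVec, dotProduct, mul_comm]

lemma eigenvectorUnitary_transpose_mul_self {A : Matrix ι ι ℝ} (hA : A.IsHermitian) :
    (hA.eigenvectorUnitary : Matrix ι ι ℝ)ᵀ * (hA.eigenvectorUnitary : Matrix ι ι ℝ) = 1 := by
  have := Unitary.coe_star_mul_self hA.eigenvectorUnitary
  rwa [Matrix.star_eq_conjTranspose, Matrix.conjTranspose_eq_transpose_of_trivial] at this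

lemma eigenvectorUnitary_transpose_mul_mul {A : Matrix ι ι ℝ} (hA : A.IsHermitian) :
    (hA.eigenvectorUnitary : Matrix ι ι ℝ)ᵀ * A * (hA.eigenvectorUnitary : Matrix ι ι ℝ) =
      Matrix.diagonal hA.eigenvalues := by
  have := hA.conjStarAlgAut_star_eigenvectorUnitary
  simp only [Unitary.conjStarAlgAut_star_apply] at this
  rw [Matrix.star_eq_conjTranspose, Matrix.conjTranspose_eq_transpose_of_trivial] at this
  simpa using this

lemma trace_sq_eq_sum_eigenvalues_sq {A : Matrix ι ι ℝ} (hA : A.IsHermitian) :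
    (A ^ 2).trace = ∑ i, hA.eigenvalues i ^ 2 := by
  set U := (hA.eigenvectorUnitary : Matrix ι ι ℝ)
  have h1 : Uᵀ * U = 1 := eigenvectorUnitary_transpose_mul_self hA
  have h2 : U * Uᵀ = 1 := mul_eq_one_comm.1 h1
  have h3 : Uᵀ * A ^ 2 * U = Matrix.diagonal hA.eigenvalues * Matrix.diagonal hA.eigenvalues := by
    rw [← eigenvectorUnitary_transpose_mul_mul hA]
    calc Uᵀ * A ^ 2 * U = Uᵀ * A * 1 * A * U := by rw [sq]; simp [Matrix.mul_assoc]
      _ = _ := by rw [← h2]; simp only [Matrix.mul_assoc]; rfl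
  calc (A ^ 2).trace = (Uᵀ * A ^ 2 * U).trace := by
        rw [Matrix.trace_mul_comm, ← Matrix.mul_assoc, h2, Matrix.one_mul]
    _ = _ := by
        rw [h3, Matrix.diagonal_mul_diagonal, Matrix.trace_diagonal]
        simp [sq]

/-- Completing the square when the columns of `E` are orthogonal. -/
lemma sum_mul_add_sq_le (E : Matrix κ ι ℝ) (q : ι → ℝ) (hE : Eᵀ * E = Matrix.diagonal q)
    (m : κ → ℝ) (z : ι → ℝ) :
    ∑ i, q i * (z i + (Eᵀ *ᵥ m) i / q i) ^ 2 ≤ (E *ᵥ z + m) ⬝ᵥ (E *ᵥ z + m) := by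
  set a : ι → ℝ := fun i => (Eᵀ *ᵥ m) i / q i with ha
  set r : κ → ℝ := m - E *ᵥ a with hr
  have hr0 : Eᵀ *ᵥ r = 0 := by
    rw [hr, Matrix.mulVec_sub, Matrix.mulVec_mulVec, hE]
    ext i
    simp only [Pi.sub_apply, Matrix.mulVec_diagonal, ha, Pi.zero_apply]
    -- If q i = 0, the i-th column of E vanishes, so the default value a i = x / 0 = 0 does no harm.
    by_cases hq : q i = 0
    · have h1 : ∑ s, E s i * E s i = 0 := by
        have := congrFun (congrFun hE i) i
        simpa [Matrix.mul_apply, hq] using this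
      have h2 := (Finset.sum_eq_zero_iff_of_nonneg fun s _ => mul_self_nonneg (E s i)).1 h1
      have h3 : ∀ s, E s i = 0 := fun s => mul_self_eq_zero.1 (h2 s (Finset.mem_univ s))
      simp [hq, Matrix.mulVec, dotProduct, h3]
    · field_simp
      ring
  have h1 : E *ᵥ z + m = E *ᵥ (z + a) + r := by
    rw [hr, Matrix.mulVec_add]; abel
  have h2 : (E *ᵥ (z + a)) ⬝ᵥ r = 0 := by
    rw [dotProduct_comm, Matrix.dotProduct_mulVec, ← Matrix.mulVec_transpose, hr0, zero_dotProduct]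
  have h3 : (E *ᵥ (z + a)) ⬝ᵥ (E *ᵥ (z + a)) = ∑ i, q i * (z i + a i) ^ 2 := by
    rw [mulVec_dotProduct_mulVec_self, hE]
    simp only [dotProduct, Matrix.mulVec_diagonal, Pi.add_apply]
    exact Finset.sum_congr rfl fun i _ => by ring
  rw [h1, add_dotProduct, dotProduct_add, dotProduct_add, h2, dotProduct_comm r, h2, h3]
  have : 0 ≤ r ⬝ᵥ r := Finset.sum_nonneg fun i _ => mul_self_nonneg _
  linarith

lemma transpose_mul_eigenvectorUnitary (D : Matrix κ ι ℝ) (hA : (Dᵀ * D).IsHermitian) :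
    (D * (hA.eigenvectorUnitary : Matrix ι ι ℝ))ᵀ * (D * (hA.eigenvectorUnitary : Matrix ι ι ℝ)) =
      Matrix.diagonal hA.eigenvalues := by
  rw [← eigenvectorUnitary_transpose_mul_mul hA, Matrix.transpose_mul]
  simp only [Matrix.mul_assoc]

/-- The Laplace transform of a noncentral Gaussian quadratic form `|D w + m|²`, bounded uniformly
in the offset `m`. -/
lemma lintegral_exp_neg_sq_le (D : Matrix κ ι ℝ) (m : κ → ℝ) {s : ℝ} (hs : 0 ≤ s) :
    ∫⁻ w, ENNReal.ofReal (Real.exp (-s * ((D *ᵥ w + m) ⬝ᵥ (D *ᵥ w + m)))) ∂(gaussianPi ι) ≤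
      ENNReal.ofReal (Real.exp (-s * (Dᵀ * D).trace + s ^ 2 * ((Dᵀ * D) ^ 2).trace)) := by
  have hA := isHermitian_gram D
  have hE := transpose_mul_eigenvectorUnitary D hA
  set U := (hA.eigenvectorUnitary : Matrix ι ι ℝ) with hU
  set q := hA.eigenvalues with hq
  have hq0 : ∀ i, 0 ≤ q i := fun i => by
    have := congrFun (congrFun hE i) i
    rw [Matrix.diagonal_apply_eq, Matrix.mul_apply] at this
    rw [← this]
    exact Finset.sum_nonneg fun s _ => mul_self_nonneg _
  have hmp := measurePreserving_eigenvectorUnitary hA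
  have hcont : Continuous fun w : ι → ℝ => Real.exp (-s * ((D *ᵥ w + m) ⬝ᵥ (D *ᵥ w + m))) := by
    fun_prop
  have hsq : ∀ i, -(1 / 2) < s * q i := fun i => by
    have := mul_nonneg hs (hq0 i); linarith
  set a : ι → ℝ := fun i => ((D * U)ᵀ *ᵥ m) i / q i with ha
  rw [← hmp.lintegral_comp (by fun_prop)]
  calc ∫⁻ z, ENNReal.ofReal (Real.exp (-s * ((D *ᵥ (U *ᵥ z) + m) ⬝ᵥ (D *ᵥ (U *ᵥ z) + m))))
        ∂(gaussianPi ι)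
      ≤ ∫⁻ z, ENNReal.ofReal (Real.exp (-∑ i, s * q i * (z i + a i) ^ 2)) ∂(gaussianPi ι) := by
        refine lintegral_mono fun z => ENNReal.ofReal_le_ofReal (Real.exp_le_exp.2 ?_)
        have h := mul_le_mul_of_nonneg_left (sum_mul_add_sq_le (D * U) q hE m z) hs
        rw [Finset.mul_sum] at h
        rw [Matrix.mulVec_mulVec, neg_mul, neg_le_neg_iff]
        simpa only [mul_assoc] using h
    _ = _ := lintegral_exp_neg_sum_mul_sq _ a hsq
    _ ≤ _ := by
        refine ENNReal.ofReal_le_ofReal ?_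
        rw [hA.trace_eq_sum_eigenvalues, trace_sq_eq_sum_eigenvalues_sq hA, Finset.mul_sum,
          Finset.mul_sum, ← Finset.sum_add_distrib, Real.exp_sum]
        refine Finset.prod_le_prod (fun i _ => by positivity) fun i _ => ?_
        have h0 := mul_nonneg hs (hq0 i)
        -- The offset survives only in the exponential of a nonpositive number; dropping that factor
        -- makes the bound uniform in m.
        refine (mul_le_of_le_one_right (by positivity) (Real.exp_le_one_iff.2 ?_)).trans
          ((inv_sqrt_one_add_le h0).trans_eq ?_)
        · refine div_nonpos_of_nonpos_of_nonneg ?_ (by positivity)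
          exact mul_nonpos_of_nonpos_of_nonneg (by linarith) (sq_nonneg _)
        · simp only [RCLike.ofReal_real_eq_id, id_eq]
          congr 1
          ring

/-- In an eigenbasis of DᵀD each coordinate contributes (1 - 2sq)^(-1/2) with sq ≤ 1/4. The
hypothesis concerns DDᵀ, since the available bound comes from the covariance LLᵀ. -/
lemma lintegral_exp_sq_le (D : Matrix κ ι ℝ) {s Λ : ℝ} (hs : 0 ≤ s)
    (hΛ : ∀ y, (Dᵀ *ᵥ y) ⬝ᵥ (Dᵀ *ᵥ y) ≤ Λ * (y ⬝ᵥ y)) (hsΛ : s * Λ ≤ 1 / 4) :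
    ∫⁻ w, ENNReal.ofReal (Real.exp (s * ((D *ᵥ w) ⬝ᵥ (D *ᵥ w)))) ∂(gaussianPi ι) ≤
      ENNReal.ofReal (Real.exp (3 / 2 * s * (Dᵀ * D).trace)) := by
  have hA := isHermitian_gram D
  have hE := transpose_mul_eigenvectorUnitary D hA
  set U := (hA.eigenvectorUnitary : Matrix ι ι ℝ) with hU
  set q := hA.eigenvalues with hq
  have hcol : ∀ i, ((D * U) *ᵥ Pi.single i 1) ⬝ᵥ ((D * U) *ᵥ Pi.single i 1) = q i := fun i => by
    rw [mulVec_dotProduct_mulVec_self, hE]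
    simp
  have hq0 : ∀ i, 0 ≤ q i := fun i => by
    rw [← hcol i]
    exact Finset.sum_nonneg fun s _ => mul_self_nonneg _
  have hqs : ∀ i, s * q i ≤ 1 / 4 := fun i => by
    rcases (hq0 i).eq_or_lt with h | h
    · rw [← h]; norm_num
    -- Testing DDᵀ on the image under D of the i-th eigenvector gives q i² ≤ Λ q i, which bounds
    -- every nonzero eigenvalue of DᵀD.
    · have h1 := hΛ ((D * U) *ᵥ Pi.single i 1)
      have h2 : Dᵀ *ᵥ ((D * U) *ᵥ Pi.single i 1) = q i • (U *ᵥ Pi.single i 1) := by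
        rw [Matrix.mulVec_mulVec, ← Matrix.mul_assoc, ← Matrix.mulVec_mulVec,
          hA.eigenvectorUnitary_mulVec, hA.mulVec_eigenvectorBasis]
      have h3 : (U *ᵥ Pi.single i 1) ⬝ᵥ (U *ᵥ Pi.single i 1) = 1 := by
        rw [mulVec_dotProduct_mulVec_self, eigenvectorUnitary_transpose_mul_self hA]
        simp
      rw [h2, hcol, smul_dotProduct, dotProduct_smul, h3] at h1
      have h4 : q i ≤ Λ := by
        simp only [smul_eq_mul, mul_one] at h1
        exact le_of_mul_le_mul_right h1 h
      exact (mul_le_mul_of_nonneg_left h4 hs).trans hsΛ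
  have hmp := measurePreserving_eigenvectorUnitary hA
  have hcont : Continuous fun w : ι → ℝ => Real.exp (s * ((D *ᵥ w) ⬝ᵥ (D *ᵥ w))) := by
    fun_prop
  rw [← hmp.lintegral_comp (by fun_prop)]
  calc ∫⁻ z, ENNReal.ofReal (Real.exp (s * ((D *ᵥ (U *ᵥ z)) ⬝ᵥ (D *ᵥ (U *ᵥ z)))))
        ∂(gaussianPi ι)
      = ∫⁻ z, ENNReal.ofReal (Real.exp (-∑ i, -(s * q i) * (z i + (0 : ι → ℝ) i) ^ 2))
        ∂(gaussianPi ι) := by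
        refine lintegral_congr fun z => ?_
        rw [Matrix.mulVec_mulVec, mulVec_dotProduct_mulVec_self, hE]
        simp only [dotProduct, Matrix.mulVec_diagonal, Finset.mul_sum, Pi.zero_apply, add_zero,
          neg_mul, Finset.sum_neg_distrib, neg_neg]
        congr 2
        exact Finset.sum_congr rfl fun i _ => by ring
    _ = _ := lintegral_exp_neg_sum_mul_sq _ 0 fun i => by have := hqs i; linarith
    _ ≤ _ := by
        refine ENNReal.ofReal_le_ofReal ?_
        rw [hA.trace_eq_sum_eigenvalues, Finset.mul_sum, Real.exp_sum]
        refine Finset.prod_le_prod (fun i _ => by positivity) fun i _ => ?_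
        have h := inv_sqrt_one_sub_le (mul_nonneg hs (hq0 i)) (hqs i)
        simp only [Pi.zero_apply, RCLike.ofReal_real_eq_id, id_eq]
        rw [show 1 + 2 * -(s * q i) = 1 - 2 * (s * q i) by ring]
        simpa [mul_assoc] using h

end GaussianIntegrals

/-! ### Decoupling of block triangular forms by successive integration. -/

section BlockTriangular

variable {ι κ : Type*} [Fintype ι] [Fintype κ]

/-- The `j`-th diagonal block of a matrix whose rows and columns are graded by `ℕ`. -/
def diagBlock (βr : κ → ℕ) (βc : ι → ℕ) (B : Matrix κ ι ℝ) (j : ℕ) :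
    Matrix {r // βr r = j} {i // βc i = j} ℝ :=
  B.submatrix Subtype.val Subtype.val

lemma lintegral_gaussianPi_split (p : ι → Prop) [DecidablePred p] {f : (ι → ℝ) → ENNReal}
    (hf : Measurable f) :
    ∫⁻ w, f w ∂(gaussianPi ι) =
      ∫⁻ y, ∫⁻ x, f ((Equiv.piEquivPiSubtypeProd p fun _ => ℝ).symm (x, y))
        ∂(gaussianPi {i // p i}) ∂(gaussianPi {i // ¬ p i}) := by
  have h := (measurePreserving_piEquivPiSubtypeProd (fun _ : ι => gaussianReal 0 1) p).symm
  unfold gaussianPi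
  rw [← h.lintegral_comp hf]
  exact lintegral_prod_symm _ (hf.comp h.measurable).aemeasurable

variable [DecidableEq ι] [DecidableEq κ]

/-- For a block lower triangular matrix, the Laplace transform of the quadratic form `|B w|²` is
controlled by the diagonal blocks of `B` only. -/
lemma lintegral_exp_neg_blockTriangular_le (βr : κ → ℕ) (βc : ι → ℕ) (B : Matrix κ ι ℝ)
    (hB : ∀ r i, βr r < βc i → B r i = 0) {s : ℝ} (hs : 0 ≤ s) (n : ℕ) :
    ∫⁻ w, ENNReal.ofReal (Real.exp (-s * ∑ r with βr r < n, (B *ᵥ w) r ^ 2)) ∂(gaussianPi ι) ≤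
      ENNReal.ofReal (Real.exp (∑ j ∈ Finset.range n,
        (-s * ((diagBlock βr βc B j)ᵀ * diagBlock βr βc B j).trace +
          s ^ 2 * (((diagBlock βr βc B j)ᵀ * diagBlock βr βc B j) ^ 2).trace))) := by
  induction n with
  | zero => simp
  | succ n ih =>
    have hmeas : ∀ m : ℕ, Measurable fun w : ι → ℝ =>
        ENNReal.ofReal (Real.exp (-s * ∑ r with βr r < m, (B *ᵥ w) r ^ 2)) := fun m => by
      have : Continuous fun w : ι → ℝ =>
          Real.exp (-s * ∑ r with βr r < m, (B *ᵥ w) r ^ 2) := by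
        have h : ∀ r, Continuous fun w : ι → ℝ => (B *ᵥ w) r := fun r =>
          (continuous_apply r).comp (by fun_prop : Continuous fun w : ι → ℝ => B *ᵥ w)
        fun_prop
      fun_prop
    -- The coordinates x of column block n are integrated first, with the others y fixed. Rows of
    -- grade below n do not see x, by triangularity, and may be evaluated at x = 0; rows of grade n
    -- read D x + m with m depending on y only.
    set e := (Equiv.piEquivPiSubtypeProd (fun i => βc i = n) fun _ => ℝ).symm with he
    set D := diagBlock βr βc B n with hD
    have hsplit : ∀ x y r, (B *ᵥ e (x, y)) r =
        ∑ i : {i // βc i = n}, B r i * x i + (B *ᵥ e (0, y)) r := by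
      intro x y r
      simp only [Matrix.mulVec, dotProduct]
      rw [← Fintype.sum_subtype_add_sum_subtype (fun i => βc i = n),
        ← Fintype.sum_subtype_add_sum_subtype (fun i => βc i = n) (fun i => B r i * e (0, y) i)]
      have h1 : ∀ x : {i // βc i = n} → ℝ, ∀ i : {i // βc i = n}, e (x, y) i = x i := by
        intro x i; simp [he, i.2]
      have h2 : ∀ i : {i // ¬ βc i = n}, e (x, y) i = e (0, y) i := by
        intro i; simp [he, i.2]
      simp [h1, h2]
    have hlow : ∀ x y, ∑ r with βr r < n, (B *ᵥ e (x, y)) r ^ 2 =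
        ∑ r with βr r < n, (B *ᵥ e (0, y)) r ^ 2 := by
      intro x y
      refine Finset.sum_congr rfl fun r hr => ?_
      rw [hsplit x y r, Finset.sum_eq_zero, zero_add]
      intro i _
      rw [hB r i (by rw [i.2]; exact (Finset.mem_filter.1 hr).2), zero_mul]
    have htop : ∀ x y, ∑ r with βr r = n, (B *ᵥ e (x, y)) r ^ 2 =
        (D *ᵥ x + fun r => (B *ᵥ e (0, y)) r.1) ⬝ᵥ (D *ᵥ x + fun r => (B *ᵥ e (0, y)) r.1) := by
      intro x y
      rw [Finset.sum_subtype (p := fun r => βr r = n) _ (by simp)]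
      refine Finset.sum_congr rfl fun r _ => ?_
      rw [hsplit x y r, sq]
      rfl
    have hfac : ∀ w : ι → ℝ,
        ENNReal.ofReal (Real.exp (-s * ∑ r with βr r < n + 1, (B *ᵥ w) r ^ 2)) =
        ENNReal.ofReal (Real.exp (-s * ∑ r with βr r < n, (B *ᵥ w) r ^ 2)) *
          ENNReal.ofReal (Real.exp (-s * ∑ r with βr r = n, (B *ᵥ w) r ^ 2)) := by
      intro w
      rw [← ENNReal.ofReal_mul (Real.exp_pos _).le, ← Real.exp_add, ← mul_add,
        ← Finset.sum_union, ← Finset.filter_or]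
      · simp only [Nat.lt_succ_iff_lt_or_eq]
      · rw [Finset.disjoint_filter]
        intro r _ h1 h2
        omega
    rw [Finset.sum_range_succ, Real.exp_add, ENNReal.ofReal_mul (Real.exp_pos _).le]
    refine le_trans ?_ (mul_le_mul_left ih _)
    rw [lintegral_gaussianPi_split (fun i => βc i = n) (hmeas (n + 1)),
      lintegral_gaussianPi_split (fun i => βc i = n) (hmeas n), ← lintegral_mul_const']
    · refine lintegral_mono fun y => ?_
      simp_rw [hfac, ← he, hlow, htop]
      rw [lintegral_const_mul', lintegral_const]
      · simp only [measure_univ, mul_one]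
        exact mul_le_mul_right (lintegral_exp_neg_sq_le D _ hs) _
      · exact ENNReal.ofReal_ne_top
    · exact ENNReal.ofReal_ne_top

end BlockTriangular

/-! ### Time blocks, scalar projections and the matrices Q_j. -/

section Blocks

variable {T k d p d' : ℕ}

/-- The times of the `j`-th block. -/
def blockTimeEquiv (hk : 0 < k) (j : Fin (T / k)) : Fin k ≃ {t : Fin T // (t : ℕ) / k = j} :=
  Equiv.ofBijective (fun a => ⟨blockTime j a, by
    simp only [blockTime]
    rw [mul_comm, Nat.mul_add_div hk, Nat.div_eq_of_lt a.2, add_zero]⟩) (by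
    constructor
    · intro a b h
      simpa [blockTime, Fin.ext_iff] using h
    · rintro ⟨t, ht⟩
      refine ⟨⟨t % k, Nat.mod_lt _ hk⟩, ?_⟩
      simp only [blockTime, Subtype.mk.injEq, Fin.ext_iff]
      rw [← ht]
      exact Nat.div_add_mod' _ _)

/-- The column indices of the `j`-th block. -/
def blockColEquiv (hk : 0 < k) (j : Fin (T / k)) :
    Fin k × Fin p ≃ {c : Fin T × Fin p // (c.1 : ℕ) / k = j} where
  toFun c := ⟨((blockTimeEquiv hk j c.1).1, c.2), (blockTimeEquiv hk j c.1).2⟩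
  invFun c := ((blockTimeEquiv hk j).symm ⟨c.1.1, c.2⟩, c.1.2)
  left_inv c := by simp
  right_inv c := by simp

/-- The matrix of the scalar process `⟨u, X_t⟩` when `X = L W`. -/
def projMatrix (u : Fin d → ℝ) (L : Matrix (Fin T × Fin d) (Fin T × Fin p) ℝ) :
    Matrix (Fin T) (Fin T × Fin p) ℝ :=
  Matrix.of fun t c => ∑ i, u i * L (t, i) c

/-- When ΔᵀΔ has rank one, Q_j is the Gram matrix of a diagonal block of the projected process, up
to relabelling. This links ψ to the Laplace bound, and only traces of powers are needed from it. -/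
lemma blockGram_eq_submatrix (hk : 0 < k) (L : Matrix (Fin T × Fin d) (Fin T × Fin p) ℝ)
    (u : Fin d → ℝ) (Δ : Matrix (Fin d') (Fin d) ℝ) (hΔ : Δᵀ * Δ = Matrix.vecMulVec u u)
    (j : Fin (T / k)) :
    blockGram k L Δ j =
      ((diagBlock (fun t : Fin T => (t : ℕ) / k) (fun c : Fin T × Fin p => (c.1 : ℕ) / k)
        (projMatrix u L) j)ᵀ *
      diagBlock (fun t : Fin T => (t : ℕ) / k) (fun c : Fin T × Fin p => (c.1 : ℕ) / k)
        (projMatrix u L) j).submatrix (blockColEquiv hk j) (blockColEquiv hk j) := by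
  ext c c'
  rw [blockGram, hΔ, Matrix.submatrix_apply, Matrix.mul_apply, Matrix.mul_apply,
    ← (blockTimeEquiv hk j).sum_comp, Fintype.sum_prod_type]
  simp only [Matrix.mul_apply, Fintype.sum_prod_type, Matrix.transpose_apply]
  simp only [diagBlock, projMatrix, Matrix.submatrix_apply, Matrix.kroneckerMap_apply,
    Matrix.of_apply, Matrix.one_apply, Matrix.vecMulVec_apply, block]
  refine Finset.sum_congr rfl fun a _ => ?_
  rw [Finset.sum_mul_sum, Finset.sum_comm]
  simp only [ite_mul, one_mul, zero_mul, mul_ite, mul_zero, Finset.sum_mul]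
  refine Finset.sum_congr rfl fun x _ => ?_
  rw [Finset.sum_eq_single a (fun b _ hb => by simp [hb]) (by simp)]
  refine Finset.sum_congr rfl fun y _ => ?_
  rw [if_pos rfl]
  change _ = u y * L (blockTime j a, y) (blockTime j c.1, c.2) *
    (u x * L (blockTime j a, x) (blockTime j c'.1, c'.2))
  ring

lemma trace_submatrix_pow {m n : Type*} [Fintype m] [DecidableEq m] [Fintype n] [DecidableEq n]
    (e : m ≃ n) (Q : Matrix n n ℝ) (l : ℕ) : ((Q.submatrix e e) ^ l).trace = (Q ^ l).trace := by
  have h : (Q.submatrix e e) ^ l = (Q ^ l).submatrix e e :=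
    (map_pow (Matrix.reindexAlgEquiv ℝ ℝ e.symm) Q l).symm
  rw [h]
  exact e.sum_comp fun i => (Q ^ l) i i

lemma trace_blockGram (hk : 0 < k) (L : Matrix (Fin T × Fin d) (Fin T × Fin p) ℝ)
    (u : Fin d → ℝ) (Δ : Matrix (Fin d') (Fin d) ℝ) (hΔ : Δᵀ * Δ = Matrix.vecMulVec u u)
    (j : Fin (T / k)) (n : ℕ) :
    (blockGram k L Δ j ^ n).trace =
      (((diagBlock (fun t : Fin T => (t : ℕ) / k) (fun c : Fin T × Fin p => (c.1 : ℕ) / k)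
        (projMatrix u L) j)ᵀ *
      diagBlock (fun t : Fin T => (t : ℕ) / k) (fun c : Fin T × Fin p => (c.1 : ℕ) / k)
        (projMatrix u L) j) ^ n).trace := by
  rw [blockGram_eq_submatrix hk L u Δ hΔ j]
  exact trace_submatrix_pow _ _ _

/-- The Laplace transform of `∑ₜ ⟨u, X_t⟩²` for a causal process, in terms of the decoupled one. -/
lemma lintegral_exp_neg_causal_le (hk : 0 < k) (hkT : k ∣ T)
    (L : Matrix (Fin T × Fin d) (Fin T × Fin p) ℝ)
    (hL : ∀ i j : Fin (T / k), i < j → block k L i j = 0)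
    (u : Fin d → ℝ) (Δ : Matrix (Fin d') (Fin d) ℝ) (hΔ : Δᵀ * Δ = Matrix.vecMulVec u u)
    {s : ℝ} (hs : 0 ≤ s) :
    ∫⁻ w, ENNReal.ofReal (Real.exp (-s * ∑ t, (projMatrix u L *ᵥ w) t ^ 2))
        ∂(gaussianPi (Fin T × Fin p)) ≤
      ENNReal.ofReal (Real.exp (-s * ∑ j : Fin (T / k), (blockGram k L Δ j).trace +
        s ^ 2 * ∑ j : Fin (T / k), (blockGram k L Δ j ^ 2).trace)) := by
  have hdiv : ∀ t : Fin T, (t : ℕ) / k < T / k := fun t =>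
    (Nat.div_lt_iff_lt_mul hk).2 (by rw [Nat.div_mul_cancel hkT]; exact t.2)
  have hB : ∀ (r : Fin T) (c : Fin T × Fin p), (r : ℕ) / k < (c.1 : ℕ) / k →
      projMatrix u L r c = 0 := by
    intro r c h
    have h0 := hL ⟨r / k, hdiv r⟩ ⟨c.1 / k, hdiv c.1⟩ h
    rw [projMatrix, Matrix.of_apply]
    refine Finset.sum_eq_zero fun i _ => ?_
    have h1 := congrFun (congrFun h0 (⟨r % k, Nat.mod_lt _ hk⟩, i)) (⟨c.1 % k, Nat.mod_lt _ hk⟩, c.2)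
    have h2 : ∀ t : Fin T, blockTime (⟨t / k, hdiv t⟩ : Fin (T / k)) ⟨t % k, Nat.mod_lt _ hk⟩ = t :=
      fun t => Fin.ext (Nat.div_add_mod' _ _)
    simp only [block, Matrix.submatrix_apply, h2, Matrix.zero_apply] at h1
    rw [h1, mul_zero]
  have h := lintegral_exp_neg_blockTriangular_le (fun t : Fin T => (t : ℕ) / k)
    (fun c : Fin T × Fin p => (c.1 : ℕ) / k) (projMatrix u L) hB hs (T / k)
  rw [Finset.filter_true_of_mem fun t _ => hdiv t] at h
  refine h.trans_eq ?_
  congr 2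
  rw [Finset.sum_range, Finset.sum_add_distrib, ← Finset.mul_sum, ← Finset.mul_sum]
  have h1 := fun j => trace_blockGram hk L u Δ hΔ j 1
  have h2 := fun j => trace_blockGram hk L u Δ hΔ j 2
  simp only [pow_one] at h1
  simp_rw [h1, h2]

end Blocks

/-! ### Nets on the unit sphere. -/

section Net

open Module Metric

/-- Volume comparison: the balls of radius ε/2 around the points are disjoint and lie in the ball of
radius 1 + ε/2. -/
lemma card_le_of_separated_sphere {E : Type*} [NormedAddCommGroup E] [NormedSpace ℝ E]
    [FiniteDimensional ℝ E] {ε : ℝ} (hε : 0 < ε) (s : Finset E) (hs : ∀ c ∈ s, ‖c‖ = 1)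
    (h : ∀ c ∈ s, ∀ d ∈ s, c ≠ d → ε ≤ ‖c - d‖) :
    (s.card : ℝ) ≤ (1 + 2 / ε) ^ finrank ℝ E := by
  borelize E
  let μ : Measure E := Measure.addHaar
  set δ : ℝ := ε / 2 with hδ
  set ρ : ℝ := 1 + ε / 2 with hρ
  have hδ0 : 0 < δ := by positivity
  have hρ0 : 0 < ρ := by positivity
  set A := ⋃ c ∈ s, ball (c : E) δ with hA
  have D : Set.Pairwise (s : Set E) (Function.onFun Disjoint fun c => ball (c : E) δ) := by
    rintro c hc d hd hcd
    apply ball_disjoint_ball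
    rw [dist_eq_norm]
    convert h c hc d hd hcd
    rw [hδ]; ring
  have A_subset : A ⊆ ball (0 : E) ρ := by
    refine Set.iUnion₂_subset fun x hx => ?_
    apply ball_subset_ball'
    rw [dist_zero_right, hs x hx, hδ, hρ, add_comm]
  have I : (s.card : ENNReal) * ENNReal.ofReal (δ ^ finrank ℝ E) * μ (ball 0 1) ≤
      ENNReal.ofReal (ρ ^ finrank ℝ E) * μ (ball 0 1) :=
    calc
      (s.card : ENNReal) * ENNReal.ofReal (δ ^ finrank ℝ E) * μ (ball 0 1) = μ A := by
        rw [hA, measure_biUnion_finset D fun c _ => measurableSet_ball]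
        simp only [μ.addHaar_ball_of_pos _ hδ0, Finset.sum_const, nsmul_eq_mul, mul_assoc]
      _ ≤ μ (ball (0 : E) ρ) := measure_mono A_subset
      _ = ENNReal.ofReal (ρ ^ finrank ℝ E) * μ (ball 0 1) := by
        simp only [μ.addHaar_ball_of_pos _ hρ0]
  have J : (s.card : ENNReal) * ENNReal.ofReal (δ ^ finrank ℝ E) ≤
      ENNReal.ofReal (ρ ^ finrank ℝ E) :=
    (ENNReal.mul_le_mul_iff_left (measure_ball_pos _ _ zero_lt_one).ne' measure_ball_lt_top.ne).1 I
  have K := ENNReal.toReal_le_of_le_ofReal (pow_nonneg hρ0.le _) J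
  rw [ENNReal.toReal_mul, ENNReal.toReal_natCast, ENNReal.toReal_ofReal (by positivity),
    ← le_div_iff₀ (by positivity), ← div_pow] at K
  rwa [show 1 + 2 / ε = ρ / δ by rw [hδ, hρ]; field_simp; ring]

/-- The unit sphere has an `ε`-net of at most `(1 + 2 / ε) ^ d` points. -/
lemma exists_net (d : ℕ) {ε : ℝ} (hε : 0 < ε) :
    ∃ N : Finset (Fin d → ℝ), (N.card : ℝ) ≤ (1 + 2 / ε) ^ d ∧ (∀ u ∈ N, u ⬝ᵥ u = 1) ∧
      ∀ v : Fin d → ℝ, v ⬝ᵥ v = 1 → ∃ u ∈ N, (v - u) ⬝ᵥ (v - u) ≤ ε ^ 2 := by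
  classical
  let Good : Finset (EuclideanSpace ℝ (Fin d)) → Prop := fun s =>
    (∀ c ∈ s, ‖c‖ = 1) ∧ ∀ c ∈ s, ∀ d ∈ s, c ≠ d → ε ≤ ‖c - d‖
  have hcard : ∀ s, Good s → (s.card : ℝ) ≤ (1 + 2 / ε) ^ d := fun s hs => by
    simpa using card_le_of_separated_sphere hε s hs.1 hs.2
  -- A separated set of maximal cardinality is a net, since a point left uncovered could be added to
  -- it.
  obtain ⟨n, ⟨s, hs, rfl⟩, hmax⟩ :
      ∃ n ∈ {n | ∃ s, Good s ∧ s.card = n}, ∀ m ∈ {n | ∃ s, Good s ∧ s.card = n}, m ≤ n := by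
    have hne : {n | ∃ s, Good s ∧ s.card = n}.Nonempty := ⟨0, ∅, by simp [Good], rfl⟩
    have hbdd : BddAbove {n | ∃ s, Good s ∧ s.card = n} := by
      refine ⟨⌊(1 + 2 / ε) ^ d⌋₊, ?_⟩
      rintro _ ⟨s, hs, rfl⟩
      exact Nat.le_floor (hcard s hs)
    exact ⟨_, Nat.sSup_mem hne hbdd, fun m hm => le_csSup hbdd hm⟩
  have hdot : ∀ x : EuclideanSpace ℝ (Fin d), x.ofLp ⬝ᵥ x.ofLp = ‖x‖ ^ 2 := fun x => by
    rw [EuclideanSpace.real_norm_sq_eq]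
    simp [dotProduct, sq]
  refine ⟨s.image (fun x => x.ofLp), ?_, ?_, ?_⟩
  · refine le_trans ?_ (hcard s hs)
    exact_mod_cast Finset.card_image_le
  · intro u hu
    obtain ⟨x, hx, rfl⟩ := Finset.mem_image.1 hu
    rw [hdot, hs.1 x hx, one_pow]
  · intro v hv
    set x : EuclideanSpace ℝ (Fin d) := WithLp.toLp 2 v with hx
    have hx1 : ‖x‖ = 1 := by
      have := hdot x
      rw [hx, hv] at this
      exact (pow_eq_one_iff_of_nonneg (norm_nonneg _) two_ne_zero).1 this.symm
    by_contra! hcon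
    have hfar : ∀ y ∈ s, ε < ‖x - y‖ := by
      intro y hy
      have := hcon y.ofLp (Finset.mem_image_of_mem _ hy)
      have h2 := hdot (x - y)
      rw [WithLp.ofLp_sub] at h2
      rw [show x.ofLp = v from rfl] at h2
      rw [h2] at this
      exact lt_of_pow_lt_pow_left₀ 2 (norm_nonneg _) this
    have hxs : x ∉ s := fun h => by
      have := hfar x h
      rw [sub_self, norm_zero] at this
      linarith
    have hgood : Good (insert x s) := by
      refine ⟨?_, ?_⟩
      · intro c hc
        rcases Finset.mem_insert.1 hc with rfl | hc
        · exact hx1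
        · exact hs.1 c hc
      · intro a ha b hb hab
        rcases Finset.mem_insert.1 ha with rfl | ha <;> rcases Finset.mem_insert.1 hb with rfl | hb
        · exact absurd rfl hab
        · exact (hfar b hb).le
        · rw [norm_sub_rev]; exact (hfar a ha).le
        · exact hs.2 a ha b hb hab
    have := hmax _ ⟨_, hgood, rfl⟩
    rw [Finset.card_insert_of_notMem hxs] at this
    omega

end Net

/-! ### Extreme eigenvalues as extrema of the Rayleigh quotient. -/

section Rayleigh

variable {n : Type*} [Fintype n] [DecidableEq n] {A : Matrix n n ℝ}

lemma dotProduct_mulVec_eq_sum_eigenvalues (hA : A.IsHermitian) (v : n → ℝ) :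
    v ⬝ᵥ A *ᵥ v = ∑ i, hA.eigenvalues i *
      ((hA.eigenvectorUnitary : Matrix n n ℝ)ᵀ *ᵥ v) i ^ 2 := by
  set U := (hA.eigenvectorUnitary : Matrix n n ℝ)
  have h1 : Uᵀ * U = 1 := eigenvectorUnitary_transpose_mul_self hA
  have h2 : U * Uᵀ = 1 := mul_eq_one_comm.1 h1
  have h3 : A = U * Matrix.diagonal hA.eigenvalues * Uᵀ := by
    rw [← eigenvectorUnitary_transpose_mul_mul hA]
    calc A = 1 * A * 1 := by simp
      _ = _ := by rw [← h2]; simp only [Matrix.mul_assoc]; rfl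
  conv_lhs => rw [h3]
  rw [← Matrix.mulVec_mulVec, ← Matrix.mulVec_mulVec, Matrix.dotProduct_mulVec,
    ← Matrix.mulVec_transpose]
  simp only [dotProduct, Matrix.mulVec_diagonal]
  exact Finset.sum_congr rfl fun i _ => by ring

lemma dotProduct_self_eq_sum_sq (hA : A.IsHermitian) (v : n → ℝ) :
    v ⬝ᵥ v = ∑ i, ((hA.eigenvectorUnitary : Matrix n n ℝ)ᵀ *ᵥ v) i ^ 2 := by
  have h1 := eigenvectorUnitary_transpose_mul_self hA
  have h := mulVec_dotProduct_mulVec_self (hA.eigenvectorUnitary : Matrix n n ℝ)ᵀ v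
  rw [Matrix.transpose_transpose, mul_eq_one_comm.1 h1, Matrix.one_mulVec] at h
  rw [← h]
  simp [dotProduct, sq]

lemma lambdaMin_mul_le (hA : A.IsHermitian) (v : n → ℝ) :
    lambdaMin A * (v ⬝ᵥ v) ≤ v ⬝ᵥ A *ᵥ v := by
  rw [dotProduct_mulVec_eq_sum_eigenvalues hA, dotProduct_self_eq_sum_sq hA, Finset.mul_sum]
  refine Finset.sum_le_sum fun i _ => mul_le_mul_of_nonneg_right ?_ (sq_nonneg _)
  exact csInf_le A.finite_real_spectrum.bddBelow (hA.eigenvalues_mem_spectrum_real i)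

lemma le_lambdaMax_mul (hA : A.IsHermitian) (v : n → ℝ) :
    v ⬝ᵥ A *ᵥ v ≤ lambdaMax A * (v ⬝ᵥ v) := by
  rw [dotProduct_mulVec_eq_sum_eigenvalues hA, dotProduct_self_eq_sum_sq hA, Finset.mul_sum]
  refine Finset.sum_le_sum fun i _ => mul_le_mul_of_nonneg_right ?_ (sq_nonneg _)
  exact le_csSup A.finite_real_spectrum.bddAbove (hA.eigenvalues_mem_spectrum_real i)

lemma exists_unit_eigenvector (hA : A.IsHermitian) {l : ℝ} (hl : l ∈ spectrum ℝ A) :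
    ∃ v : n → ℝ, v ⬝ᵥ v = 1 ∧ v ⬝ᵥ A *ᵥ v = l := by
  rw [hA.spectrum_real_eq_range_eigenvalues] at hl
  obtain ⟨i, rfl⟩ := hl
  have h1 : (hA.eigenvectorBasis i).ofLp ⬝ᵥ (hA.eigenvectorBasis i).ofLp = 1 := by
    have h := hA.eigenvectorBasis.orthonormal.1 i
    have h2 := EuclideanSpace.real_norm_sq_eq (hA.eigenvectorBasis i)
    rw [h] at h2
    simp only [dotProduct, ← sq, ← h2, one_pow]
  refine ⟨_, h1, ?_⟩
  rw [hA.mulVec_eigenvectorBasis, dotProduct_smul, h1, smul_eq_mul, mul_one]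

lemma spectrum_nonempty [Nonempty n] (hA : A.IsHermitian) : (spectrum ℝ A).Nonempty :=
  ⟨_, hA.eigenvalues_mem_spectrum_real (Classical.arbitrary n)⟩

lemma exists_eq_lambdaMin [Nonempty n] (hA : A.IsHermitian) :
    ∃ v : n → ℝ, v ⬝ᵥ v = 1 ∧ v ⬝ᵥ A *ᵥ v = lambdaMin A :=
  exists_unit_eigenvector hA ((spectrum_nonempty hA).csInf_mem A.finite_real_spectrum)

lemma exists_eq_lambdaMax [Nonempty n] (hA : A.IsHermitian) :
    ∃ v : n → ℝ, v ⬝ᵥ v = 1 ∧ v ⬝ᵥ A *ᵥ v = lambdaMax A :=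
  exists_unit_eigenvector hA ((spectrum_nonempty hA).csSup_mem A.finite_real_spectrum)

lemma lambdaMin_smul [Nonempty n] (hA : A.IsHermitian) {c : ℝ} (hc : 0 ≤ c) :
    lambdaMin (c • A) = c * lambdaMin A := by
  have hcA : (c • A).IsHermitian := by
    rw [Matrix.IsHermitian, Matrix.conjTranspose_smul, hA.eq, star_trivial]
  obtain ⟨v, hv, hv'⟩ := exists_eq_lambdaMin hA
  obtain ⟨w, hw, hw'⟩ := exists_eq_lambdaMin hcA
  have h1 := lambdaMin_mul_le hcA v
  have h2 := mul_le_mul_of_nonneg_left (lambdaMin_mul_le hA w) hc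
  rw [Matrix.smul_mulVec, dotProduct_smul, smul_eq_mul] at h1 hw'
  rw [hv', hv, mul_one] at h1
  rw [hw, mul_one, hw'] at h2
  exact le_antisymm h1 h2

end Rayleigh

/-! ### Second moments and energies in a fixed direction. -/

section Moments

variable {Ω : Type*} [MeasurableSpace Ω] {P : Measure Ω} {T k d p d' : ℕ}

lemma gaussianPi_eq_map_stdGaussian (ι : Type*) [Fintype ι] :
    (stdGaussian (EuclideanSpace ℝ ι)).map (fun x => x.ofLp) = gaussianPi ι := by
  rw [← map_pi_eq_stdGaussian, Measure.map_map (by fun_prop) (by fun_prop)]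
  exact Measure.map_id

lemma integral_dotProduct_mul_dotProduct {ι : Type*} [Fintype ι] (a b : ι → ℝ) :
    ∫ w, (a ⬝ᵥ w) * (b ⬝ᵥ w) ∂(gaussianPi ι) = a ⬝ᵥ b := by
  have h := congrArg (fun f => f (WithLp.toLp 2 a) (WithLp.toLp 2 b))
    (covarianceBilin_stdGaussian (E := EuclideanSpace ℝ ι))
  simp only at h
  rw [covarianceBilin_apply IsGaussian.memLp_two_id] at h
  rw [← gaussianPi_eq_map_stdGaussian, integral_map (by fun_prop) (by fun_prop)]
  simp only [id_eq, integral_id_stdGaussian, sub_zero, EuclideanSpace.inner_eq_star_dotProduct,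
    star_trivial, innerSL_apply_apply ℝ] at h
  simp only [dotProduct_comm] at h ⊢
  exact h

lemma secondMoment_linear {ι n : Type*} [Fintype ι] {V : Ω → EuclideanSpace ℝ ι}
    (hV : HasLaw V (stdGaussian (EuclideanSpace ℝ ι)) P) (B : Matrix n ι ℝ) :
    secondMoment P (fun ω => B *ᵥ (V ω).ofLp) = B * Bᵀ := by
  ext i j
  have h := integral_dotProduct_mul_dotProduct (B i) (B j)
  rw [← gaussianPi_eq_map_stdGaussian, integral_map (by fun_prop) (by fun_prop),
    ← hV.integral_comp (by fun_prop)] at h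
  exact h

lemma secondMoment_congr {n : Type*} {x y : Ω → n → ℝ} (h : x =ᵐ[P] y) :
    secondMoment P x = secondMoment P y := by
  ext i j
  exact integral_congr_ae (h.mono fun ω hω => by simp only [hω])

/-- The sum over time of the second moments of the process with stacked vector `L W`. -/
def energyMatrix (L : Matrix (Fin T × Fin d) (Fin T × Fin p) ℝ) : Matrix (Fin d) (Fin d) ℝ :=
  ∑ t : Fin T, L.submatrix (fun i => (t, i)) id * (L.submatrix (fun i => (t, i)) id)ᵀ

lemma sum_secondMoment_linearProcess {L : Matrix (Fin T × Fin d) (Fin T × Fin p) ℝ}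
    {W : Ω → EuclideanSpace ℝ (Fin T × Fin p)}
    (hW : HasLaw W (stdGaussian (EuclideanSpace ℝ (Fin T × Fin p))) P) :
    ∑ t, secondMoment P (linearProcess L W t) = energyMatrix L :=
  Finset.sum_congr rfl fun t _ => secondMoment_linear hW (L.submatrix (fun i => (t, i)) id)

lemma isHermitian_energyMatrix (L : Matrix (Fin T × Fin d) (Fin T × Fin p) ℝ) :
    (energyMatrix L).IsHermitian := by
  rw [Matrix.IsHermitian, Matrix.conjTranspose_eq_transpose_of_trivial, energyMatrix,
    Matrix.transpose_sum]
  simp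

lemma transpose_submatrix_mulVec_eq (L : Matrix (Fin T × Fin d) (Fin T × Fin p) ℝ)
    (u : Fin d → ℝ) (t : Fin T) :
    (L.submatrix (fun i => (t, i)) id)ᵀ *ᵥ u = projMatrix u L t := by
  ext c
  simp [Matrix.mulVec, dotProduct, projMatrix, mul_comm]

lemma dotProduct_energyMatrix_mulVec (L : Matrix (Fin T × Fin d) (Fin T × Fin p) ℝ)
    (u : Fin d → ℝ) :
    u ⬝ᵥ energyMatrix L *ᵥ u = ∑ t, ∑ c, projMatrix u L t c ^ 2 := by
  rw [energyMatrix, Matrix.sum_mulVec, dotProduct_sum]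
  refine Finset.sum_congr rfl fun t _ => ?_
  have h := mulVec_dotProduct_mulVec_self (L.submatrix (fun i => (t, i)) id)ᵀ u
  rw [Matrix.transpose_transpose] at h
  rw [← h, transpose_submatrix_mulVec_eq]
  simp [dotProduct, sq]

lemma trace_gram {ι κ : Type*} [Fintype ι] [Fintype κ] (B : Matrix κ ι ℝ) :
    (Bᵀ * B).trace = ∑ r, ∑ c, B r c ^ 2 := by
  rw [Finset.sum_comm]
  simp [Matrix.trace, Matrix.mul_apply, sq]

/-- Both sides sum the squared entries of `projMatrix u L` in the diagonal blocks. Thus the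
decoupled energy is the quantity squared in the numerator of ψ. -/
lemma dotProduct_energyMatrix_blockDiagPart (hk : 0 < k) (hkT : k ∣ T)
    (L : Matrix (Fin T × Fin d) (Fin T × Fin p) ℝ)
    (u : Fin d → ℝ) (Δ : Matrix (Fin d') (Fin d) ℝ) (hΔ : Δᵀ * Δ = Matrix.vecMulVec u u) :
    u ⬝ᵥ energyMatrix (blockDiagPart k L) *ᵥ u =
      ∑ j : Fin (T / k), (blockGram k L Δ j).trace := by
  have hdiv : ∀ t : Fin T, (t : ℕ) / k < T / k := fun t =>
    (Nat.div_lt_iff_lt_mul hk).2 (by rw [Nat.div_mul_cancel hkT]; exact t.2)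
  have h1 := fun j => trace_blockGram hk L u Δ hΔ j 1
  simp only [pow_one] at h1
  simp_rw [h1, trace_gram, dotProduct_energyMatrix_mulVec]
  have h2 : ∀ j : Fin (T / k), ∑ r : {t : Fin T // (t : ℕ) / k = j},
      ∑ c : {c : Fin T × Fin p // (c.1 : ℕ) / k = j},
        diagBlock (fun t : Fin T => (t : ℕ) / k) (fun c : Fin T × Fin p => (c.1 : ℕ) / k)
          (projMatrix u L) j r c ^ 2 =
      ∑ t : Fin T, ∑ c : Fin T × Fin p, if (t : ℕ) / k = j then
        (if (c.1 : ℕ) / k = j then projMatrix u L t c ^ 2 else 0) else 0 := by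
    intro j
    have hc : ∀ t : Fin T, ∑ c : {c : Fin T × Fin p // (c.1 : ℕ) / k = j},
        projMatrix u L t c ^ 2 = ∑ c : Fin T × Fin p,
          if (c.1 : ℕ) / k = j then projMatrix u L t c ^ 2 else 0 := fun t => by
      rw [← Finset.sum_filter]
      exact (Finset.sum_subtype (p := fun c : Fin T × Fin p => (c.1 : ℕ) / k = j) _ (by simp)
        (fun c => projMatrix u L t c ^ 2)).symm
    have ht := Finset.sum_subtype (F := inferInstance) (p := fun t : Fin T => (t : ℕ) / k = j)
      (Finset.univ.filter fun t : Fin T => (t : ℕ) / k = j) (by simp)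
      (fun t => ∑ c : Fin T × Fin p, if (c.1 : ℕ) / k = j then projMatrix u L t c ^ 2 else 0)
    rw [Finset.sum_filter] at ht
    calc _ = ∑ r : {t : Fin T // (t : ℕ) / k = j}, ∑ c : Fin T × Fin p,
          if (c.1 : ℕ) / k = j then projMatrix u L r c ^ 2 else 0 :=
          Finset.sum_congr rfl fun r _ => hc r
      _ = _ := ht.symm
      _ = _ := Finset.sum_congr rfl fun t _ => by split_ifs <;> simp
  rw [Finset.sum_congr rfl fun j _ => h2 j, Finset.sum_comm (s := Finset.univ (α := Fin (T / k)))]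
  refine Finset.sum_congr rfl fun t _ => ?_
  rw [Finset.sum_comm (s := Finset.univ (α := Fin (T / k)))]
  refine Finset.sum_congr rfl fun c _ => ?_
  rw [Finset.sum_eq_single ⟨(t : ℕ) / k, hdiv t⟩]
  · simp only [projMatrix, blockDiagPart, Matrix.of_apply, if_true]
    split_ifs with h h' h'
    · rfl
    · exact absurd h.symm h'
    · exact absurd h'.symm h
    · simp
  · intro j _ hj
    rw [if_neg fun h => hj (Fin.ext h.symm)]
  · simp

lemma dotProduct_energyMatrix_blockDiagPart_le (k : ℕ)
    (L : Matrix (Fin T × Fin d) (Fin T × Fin p) ℝ) (u : Fin d → ℝ) :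
    u ⬝ᵥ energyMatrix (blockDiagPart k L) *ᵥ u ≤ u ⬝ᵥ energyMatrix L *ᵥ u := by
  rw [dotProduct_energyMatrix_mulVec, dotProduct_energyMatrix_mulVec]
  refine Finset.sum_le_sum fun t _ => Finset.sum_le_sum fun c _ => ?_
  simp only [projMatrix, blockDiagPart, Matrix.of_apply]
  split_ifs
  · rfl
  · simpa using sq_nonneg _

lemma projMatrix_mulVec (L : Matrix (Fin T × Fin d) (Fin T × Fin p) ℝ) (u : Fin d → ℝ)
    (w : Fin T × Fin p → ℝ) (t : Fin T) :
    (projMatrix u L *ᵥ w) t = u ⬝ᵥ fun i => (L *ᵥ w) (t, i) := by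
  simp only [Matrix.mulVec, dotProduct, projMatrix, Matrix.of_apply, Finset.sum_mul, Finset.mul_sum]
  rw [Finset.sum_comm]
  exact Finset.sum_congr rfl fun i _ => Finset.sum_congr rfl fun c _ => by ring

lemma dotProduct_sum_vecMulVec (x : Fin T → Fin d → ℝ) (u : Fin d → ℝ) :
    u ⬝ᵥ (∑ t, Matrix.vecMulVec (x t) (x t)) *ᵥ u = ∑ t, (u ⬝ᵥ x t) ^ 2 := by
  rw [Matrix.sum_mulVec, dotProduct_sum]
  refine Finset.sum_congr rfl fun t _ => ?_
  rw [Matrix.vecMulVec_mulVec]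
  simp [dotProduct_comm (x t) u, sq]

/-- The transpose sends y to Lᵀ(y ⊗ u), and |y ⊗ u| = |y| for a unit vector u. -/
lemma projMatrix_transpose_mulVec_sq_le (L : Matrix (Fin T × Fin d) (Fin T × Fin p) ℝ)
    {u : Fin d → ℝ} (hu : u ⬝ᵥ u = 1) (y : Fin T → ℝ) :
    ((projMatrix u L)ᵀ *ᵥ y) ⬝ᵥ ((projMatrix u L)ᵀ *ᵥ y) ≤ lambdaMax (L * Lᵀ) * (y ⬝ᵥ y) := by
  have hH : (L * Lᵀ).IsHermitian := by
    rw [Matrix.IsHermitian, Matrix.conjTranspose_eq_transpose_of_trivial]; simp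
  set z : Fin T × Fin d → ℝ := fun s => y s.1 * u s.2 with hz
  have h1 : (projMatrix u L)ᵀ *ᵥ y = Lᵀ *ᵥ z := by
    ext c
    simp only [Matrix.mulVec, dotProduct, projMatrix, Matrix.transpose_apply, Matrix.of_apply,
      Fintype.sum_prod_type, hz, Finset.sum_mul]
    exact Finset.sum_congr rfl fun t _ => Finset.sum_congr rfl fun i _ => by ring
  have h2 : z ⬝ᵥ z = y ⬝ᵥ y := by
    calc z ⬝ᵥ z = (y ⬝ᵥ y) * (u ⬝ᵥ u) := by
          simp only [dotProduct, Fintype.sum_prod_type, hz, Finset.sum_mul_sum]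
          exact Finset.sum_congr rfl fun t _ => Finset.sum_congr rfl fun i _ => by ring
      _ = _ := by rw [hu, mul_one]
  rw [h1, mulVec_dotProduct_mulVec_self, Matrix.transpose_transpose, ← h2]
  exact le_lambdaMax_mul hH z

end Moments

/-! ### Lower and upper tails in a fixed direction. -/

section Deviation

variable {T k d p d' : ℕ}

lemma measure_nonneg_le_lintegral_exp {α : Type*} [MeasurableSpace α] (μ : Measure α) {g : α → ℝ}
    (hg : Measurable g) : μ {w | 0 ≤ g w} ≤ ∫⁻ w, ENNReal.ofReal (Real.exp (g w)) ∂μ := by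
  have h := mul_meas_ge_le_lintegral (μ := μ)
    (f := fun w => ENNReal.ofReal (Real.exp (g w))) (by fun_prop) 1
  rw [one_mul] at h
  refine le_trans (measure_mono fun w hw => ?_) h
  simp only [Set.mem_ofPred_eq] at hw ⊢
  rw [ENNReal.one_le_ofReal]
  exact Real.one_le_exp hw

/-- The matrix with first row `u` and all other rows zero. -/
def firstRow (hd' : 0 < d') (u : Fin d → ℝ) : Matrix (Fin d') (Fin d) ℝ :=
  Matrix.of fun r i => if r = ⟨0, hd'⟩ then u i else 0

lemma firstRow_transpose_mul_self (hd' : 0 < d') (u : Fin d → ℝ) :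
    (firstRow hd' u)ᵀ * firstRow hd' u = Matrix.vecMulVec u u := by
  ext i j
  simp [firstRow, Matrix.mul_apply, Matrix.vecMulVec_apply]

lemma firstRow_ne_zero (hd' : 0 < d') {u : Fin d → ℝ} (hu : u ⬝ᵥ u = 1) : firstRow hd' u ≠ 0 := by
  intro h
  have h2 : u = 0 := by
    ext i
    simpa [firstRow] using congrFun (congrFun h ⟨0, hd'⟩) i
  simp [h2] at hu

lemma isHermitian_blockGram (L : Matrix (Fin T × Fin d) (Fin T × Fin p) ℝ)
    (Δ : Matrix (Fin d') (Fin d) ℝ) (j : Fin (T / k)) : (blockGram k L Δ j).IsHermitian := by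
  rw [Matrix.IsHermitian, Matrix.conjTranspose_eq_transpose_of_trivial, blockGram,
    Matrix.transpose_mul, Matrix.transpose_mul, ← Matrix.kroneckerMap_transpose]
  simp [Matrix.mul_assoc]

lemma trace_blockGram_sq_nonneg (L : Matrix (Fin T × Fin d) (Fin T × Fin p) ℝ)
    (Δ : Matrix (Fin d') (Fin d) ℝ) (j : Fin (T / k)) : 0 ≤ (blockGram k L Δ j ^ 2).trace := by
  rw [trace_sq_eq_sum_eigenvalues_sq (isHermitian_blockGram L Δ j)]
  positivity

lemma psi_nonneg (k d' : ℕ) (L : Matrix (Fin T × Fin d) (Fin T × Fin p) ℝ) : 0 ≤ psi k d' L :=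
  Real.iInf_nonneg fun _ => div_nonneg (sq_nonneg _) (mul_nonneg (Nat.cast_nonneg _)
    (Finset.sum_nonneg fun j _ => trace_blockGram_sq_nonneg L _ j))

lemma psi_mul_le (hT : 0 < T) (L : Matrix (Fin T × Fin d) (Fin T × Fin p) ℝ)
    {Δ : Matrix (Fin d') (Fin d) ℝ} (hΔ : Δ ≠ 0) :
    psi k d' L * T ≤ (∑ j : Fin (T / k), (blockGram k L Δ j).trace) ^ 2 /
      ∑ j : Fin (T / k), (blockGram k L Δ j ^ 2).trace := by
  have hT' : (0 : ℝ) < T := Nat.cast_pos.2 hT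
  have h : psi k d' L ≤ (∑ j : Fin (T / k), (blockGram k L Δ j).trace) ^ 2 /
      ((T : ℝ) * ∑ j : Fin (T / k), (blockGram k L Δ j ^ 2).trace) := by
    refine ciInf_le (f := fun Δ : {Δ : Matrix (Fin d') (Fin d) ℝ // Δ ≠ 0} =>
      (∑ j : Fin (T / k), (blockGram k L Δ.1 j).trace) ^ 2 /
      ((T : ℝ) * ∑ j : Fin (T / k), (blockGram k L Δ.1 j ^ 2).trace)) ⟨0, ?_⟩ ⟨Δ, hΔ⟩
    rintro _ ⟨Δ, rfl⟩
    exact div_nonneg (sq_nonneg _) (mul_nonneg (Nat.cast_nonneg _)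
      (Finset.sum_nonneg fun j _ => trace_blockGram_sq_nonneg L _ j))
  calc psi k d' L * T ≤ _ * (T : ℝ) := mul_le_mul_of_nonneg_right h hT'.le
    _ = _ := by rw [mul_comm (T : ℝ), ← div_div, div_mul_cancel₀ _ hT'.ne']

lemma measurable_sum_sq_mulVec {ι κ : Type*} [Fintype ι] [Fintype κ] (B : Matrix κ ι ℝ) :
    Measurable fun w : ι → ℝ => ∑ t, (B *ᵥ w) t ^ 2 := by
  have h : ∀ r, Continuous fun w : ι → ℝ => (B *ᵥ w) r := fun r =>
    (continuous_apply r).comp (by fun_prop : Continuous fun w : ι → ℝ => B *ᵥ w)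
  have : Continuous fun w : ι → ℝ => ∑ t, (B *ᵥ w) t ^ 2 := by fun_prop
  exact this.measurable

/-- The lower tail of the energy of a causal process in a fixed direction. -/
lemma measure_energy_le (hk : 0 < k) (hkT : k ∣ T) (hT : 0 < T) (hd' : 0 < d')
    (L : Matrix (Fin T × Fin d) (Fin T × Fin p) ℝ)
    (hL : ∀ i j : Fin (T / k), i < j → block k L i j = 0) {u : Fin d → ℝ} (hu : u ⬝ᵥ u = 1) :
    gaussianPi (Fin T × Fin p) {w | ∑ t, (projMatrix u L *ᵥ w) t ^ 2 ≤
        (u ⬝ᵥ energyMatrix (blockDiagPart k L) *ᵥ u) / 4} ≤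
      ENNReal.ofReal (Real.exp (-(9 / 64) * (psi k d' L * T))) := by
  have hΔ := firstRow_transpose_mul_self hd' u
  have hψ := psi_mul_le (k := k) hT L (firstRow_ne_zero hd' hu)
  have hS := dotProduct_energyMatrix_blockDiagPart hk hkT L u _ hΔ
  have hS0 : 0 ≤ u ⬝ᵥ energyMatrix (blockDiagPart k L) *ᵥ u := by
    rw [dotProduct_energyMatrix_mulVec]; positivity
  have hV0 : 0 ≤ ∑ j : Fin (T / k), (blockGram k L (firstRow hd' u) j ^ 2).trace :=
    Finset.sum_nonneg fun j _ => trace_blockGram_sq_nonneg L _ j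
  rw [← hS] at hψ
  set S := u ⬝ᵥ energyMatrix (blockDiagPart k L) *ᵥ u
  set V := ∑ j : Fin (T / k), (blockGram k L (firstRow hd' u) j ^ 2).trace with hV
  -- The minimizer of sS/4 - sS + s²V, with minimum -(9/64)S²/V. If V = 0, then s = 0 and S²/V = 0
  -- by convention, so the bound is trivial.
  set s := 3 * S / (8 * V) with hs
  have hs0 : 0 ≤ s := by positivity
  have hlap := lintegral_exp_neg_causal_le hk hkT L hL u _ hΔ hs0
  rw [← hS, ← hV] at hlap
  calc gaussianPi (Fin T × Fin p) {w | ∑ t, (projMatrix u L *ᵥ w) t ^ 2 ≤ S / 4}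
      ≤ gaussianPi (Fin T × Fin p)
          {w | 0 ≤ s * (S / 4) + -s * ∑ t, (projMatrix u L *ᵥ w) t ^ 2} := by
        refine measure_mono fun w hw => ?_
        have := mul_le_mul_of_nonneg_left (Set.mem_ofPred_eq ▸ hw) hs0
        simp only [Set.mem_ofPred_eq]
        linarith
    _ ≤ ∫⁻ w, ENNReal.ofReal (Real.exp (s * (S / 4) + -s * ∑ t, (projMatrix u L *ᵥ w) t ^ 2))
          ∂(gaussianPi (Fin T × Fin p)) := by
        have := measurable_sum_sq_mulVec (projMatrix u L)
        exact measure_nonneg_le_lintegral_exp _ (by fun_prop)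
    _ = ENNReal.ofReal (Real.exp (s * (S / 4))) *
          ∫⁻ w, ENNReal.ofReal (Real.exp (-s * ∑ t, (projMatrix u L *ᵥ w) t ^ 2))
          ∂(gaussianPi (Fin T × Fin p)) := by
        rw [← lintegral_const_mul' _ _ ENNReal.ofReal_ne_top]
        refine lintegral_congr fun w => ?_
        rw [Real.exp_add, ENNReal.ofReal_mul (Real.exp_pos _).le]
    _ ≤ ENNReal.ofReal (Real.exp (s * (S / 4))) *
          ENNReal.ofReal (Real.exp (-s * S + s ^ 2 * V)) := mul_le_mul_right hlap _
    _ ≤ _ := by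
        rw [← ENNReal.ofReal_mul (Real.exp_pos _).le, ← Real.exp_add]
        refine ENNReal.ofReal_le_ofReal (Real.exp_le_exp.2 ?_)
        have h : s * (S / 4) + (-s * S + s ^ 2 * V) = -(9 / 64) * (S ^ 2 / V) := by
          rcases hV0.eq_or_lt with h | h
          · simp [hs, ← h]
          · rw [hs]; field_simp; ring
        rw [h]
        linarith

/-- The upper tail of the energy of a Gaussian process in a fixed direction. -/
lemma measure_le_energy (L : Matrix (Fin T × Fin d) (Fin T × Fin p) ℝ)
    {u : Fin d → ℝ} (hu : u ⬝ᵥ u = 1) (hpos : 0 < u ⬝ᵥ energyMatrix L *ᵥ u) {m a q : ℝ}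
    (hm : 0 < m) (ha : 0 ≤ a) (hmM : m ≤ lambdaMax (energyMatrix L))
    (hq : q = 1 + a * lambdaMax (L * Lᵀ) / m) :
    gaussianPi (Fin T × Fin p) {w | 3 / 2 * q * lambdaMax (energyMatrix L) <
        ∑ t, (projMatrix u L *ᵥ w) t ^ 2} ≤
      ENNReal.ofReal (Real.exp (-(3 / 8) * a)) := by
  set M := lambdaMax (energyMatrix L)
  set Λ := lambdaMax (L * Lᵀ)
  have hΛ := projMatrix_transpose_mulVec_sq_le L hu
  have htr := dotProduct_energyMatrix_mulVec L u
  rw [← trace_gram] at htr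
  have htrM : ((projMatrix u L)ᵀ * projMatrix u L).trace ≤ M := by
    have := le_lambdaMax_mul (isHermitian_energyMatrix L) u
    rwa [htr, hu, mul_one] at this
  have hΛ0 : 0 < Λ := by
    by_contra! hneg
    rw [htr, trace_gram] at hpos
    refine hpos.ne' (Finset.sum_eq_zero fun t _ => ?_)
    have h1 := (hΛ (Pi.single t 1)).trans
      (mul_nonpos_of_nonpos_of_nonneg hneg (Finset.sum_nonneg fun i _ => mul_self_nonneg _))
    have h2 : ∑ c, projMatrix u L t c ^ 2 ≤ 0 := by
      simpa [dotProduct, sq] using h1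
    exact le_antisymm h2 (by positivity)
  -- The largest s allowed by `lintegral_exp_sq_le`. In the threshold, the term 1 of q cancels the
  -- trace bound (3/2)sM, and aΛ/m leaves (3/8)aM/m ≥ (3/8)a.
  set s := 1 / (4 * Λ) with hs
  have hs0 : 0 ≤ s := by positivity
  have hsΛ : s * Λ = 1 / 4 := by rw [hs]; field_simp
  have hlap := lintegral_exp_sq_le (projMatrix u L) hs0 hΛ hsΛ.le
  have hdot : ∀ w, (projMatrix u L *ᵥ w) ⬝ᵥ (projMatrix u L *ᵥ w) =
      ∑ t, (projMatrix u L *ᵥ w) t ^ 2 := fun w => by simp [dotProduct, sq]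
  simp_rw [hdot] at hlap
  calc gaussianPi (Fin T × Fin p) {w | 3 / 2 * q * M < ∑ t, (projMatrix u L *ᵥ w) t ^ 2}
      ≤ gaussianPi (Fin T × Fin p)
          {w | 0 ≤ -s * (3 / 2 * q * M) + s * ∑ t, (projMatrix u L *ᵥ w) t ^ 2} := by
        refine measure_mono fun w hw => ?_
        have := mul_le_mul_of_nonneg_left (le_of_lt (Set.mem_ofPred_eq ▸ hw)) hs0
        simp only [Set.mem_ofPred_eq]
        linarith
    _ ≤ ∫⁻ w, ENNReal.ofReal (Real.exp (-s * (3 / 2 * q * M) +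
          s * ∑ t, (projMatrix u L *ᵥ w) t ^ 2)) ∂(gaussianPi (Fin T × Fin p)) := by
        have := measurable_sum_sq_mulVec (projMatrix u L)
        exact measure_nonneg_le_lintegral_exp _ (by fun_prop)
    _ = ENNReal.ofReal (Real.exp (-s * (3 / 2 * q * M))) *
          ∫⁻ w, ENNReal.ofReal (Real.exp (s * ∑ t, (projMatrix u L *ᵥ w) t ^ 2))
          ∂(gaussianPi (Fin T × Fin p)) := by
        rw [← lintegral_const_mul' _ _ ENNReal.ofReal_ne_top]
        refine lintegral_congr fun w => ?_
        rw [Real.exp_add, ENNReal.ofReal_mul (Real.exp_pos _).le]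
    _ ≤ _ := mul_le_mul_right hlap _
    _ ≤ _ := by
        rw [← ENNReal.ofReal_mul (Real.exp_pos _).le, ← Real.exp_add]
        refine ENNReal.ofReal_le_ofReal (Real.exp_le_exp.2 ?_)
        have h1 := mul_le_mul_of_nonneg_left htrM hs0
        have h2 : s * (3 / 2 * q * M) = 3 / 2 * (s * M) + 3 / 8 * a * (M / m) := by
          rw [hq, hs]; field_simp; ring
        have h3 : 3 / 8 * a * 1 ≤ 3 / 8 * a * (M / m) :=
          mul_le_mul_of_nonneg_left ((one_le_div hm).2 hmM) (by positivity)
        linarith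

end Deviation

/-! ### Quadratic forms on nets. -/

section Discretization

variable {n : Type*} [Fintype n] {S : Matrix n n ℝ}

/-- The right side minus the left is α⁻¹ times the form at αx - y. -/
lemma quadForm_add_le (hS : S.IsHermitian) (hS0 : ∀ v, 0 ≤ v ⬝ᵥ S *ᵥ v) {α : ℝ} (hα : 0 < α)
    (x y : n → ℝ) :
    (x + y) ⬝ᵥ S *ᵥ (x + y) ≤ (1 + α) * (x ⬝ᵥ S *ᵥ x) + (1 + α⁻¹) * (y ⬝ᵥ S *ᵥ y) := by
  have hT : Sᵀ = S := by rw [← Matrix.conjTranspose_eq_transpose_of_trivial, hS.eq]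
  have hsymm : y ⬝ᵥ S *ᵥ x = x ⬝ᵥ S *ᵥ y := by
    rw [Matrix.dotProduct_mulVec, ← Matrix.mulVec_transpose, hT, dotProduct_comm]
  have h := hS0 (α • x - y)
  simp only [Matrix.mulVec_sub, Matrix.mulVec_smul, sub_dotProduct, dotProduct_sub,
    smul_dotProduct, dotProduct_smul, smul_eq_mul, hsymm] at h
  simp only [Matrix.mulVec_add, add_dotProduct, dotProduct_add, hsymm]
  have h2 := mul_nonneg (inv_nonneg.2 hα.le) h
  have h3 : α⁻¹ * α = 1 := inv_mul_cancel₀ hα.ne'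
  have h4 : α⁻¹ * (α * (α * (x ⬝ᵥ S *ᵥ x) - x ⬝ᵥ S *ᵥ y) - (α * (x ⬝ᵥ S *ᵥ y) - y ⬝ᵥ S *ᵥ y)) =
      (α⁻¹ * α) * (α * (x ⬝ᵥ S *ᵥ x)) - 2 * (α⁻¹ * α) * (x ⬝ᵥ S *ᵥ y) +
        α⁻¹ * (y ⬝ᵥ S *ᵥ y) := by ring
  rw [h4, h3] at h2
  linarith

variable [DecidableEq n]

/-- Comparing a top eigenvector with a net point, α = 1/7 gives λ ≤ (8/7)b + λ/8, and the last term
is absorbed on the left. -/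
lemma lambdaMax_le_of_net [Nonempty n] (hS : S.IsHermitian) (hS0 : ∀ v, 0 ≤ v ⬝ᵥ S *ᵥ v)
    {N : Finset (n → ℝ)}
    (hN : ∀ v : n → ℝ, v ⬝ᵥ v = 1 → ∃ u ∈ N, (v - u) ⬝ᵥ (v - u) ≤ (1 / 8) ^ 2)
    {b : ℝ} (hb : ∀ u ∈ N, u ⬝ᵥ S *ᵥ u ≤ b) : lambdaMax S ≤ 64 / 49 * b := by
  obtain ⟨v, hv, hv'⟩ := exists_eq_lambdaMax hS
  obtain ⟨u, hu, hvu⟩ := hN v hv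
  have h0 : 0 ≤ lambdaMax S := hv' ▸ hS0 v
  have h1 := quadForm_add_le hS hS0 (α := 1 / 7) (by norm_num) u (v - u)
  rw [add_sub_cancel, hv'] at h1
  have h2 := le_lambdaMax_mul hS (v - u)
  have h3 := mul_le_mul_of_nonneg_left hvu h0
  have h4 := hb u hu
  rw [show 1 + (1 / 7 : ℝ) = 8 / 7 by norm_num, show 1 + (1 / 7 : ℝ)⁻¹ = 8 by norm_num] at h1
  linarith

lemma exists_net_quadForm_le [Nonempty n] (hS : S.IsHermitian) (hS0 : ∀ v, 0 ≤ v ⬝ᵥ S *ᵥ v)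
    {N N' : Finset (n → ℝ)} {ε : ℝ}
    (hN : ∀ v : n → ℝ, v ⬝ᵥ v = 1 → ∃ u ∈ N, (v - u) ⬝ᵥ (v - u) ≤ ε ^ 2)
    (hN' : ∀ v : n → ℝ, v ⬝ᵥ v = 1 → ∃ u ∈ N', (v - u) ⬝ᵥ (v - u) ≤ (1 / 8) ^ 2)
    {b : ℝ} (hb : ∀ u ∈ N', u ⬝ᵥ S *ᵥ u ≤ b) :
    ∃ u ∈ N, u ⬝ᵥ S *ᵥ u ≤ 7 / 5 * lambdaMin S + 7 / 2 * (64 / 49 * b) * ε ^ 2 := by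
  have hmax := lambdaMax_le_of_net hS hS0 hN' hb
  obtain ⟨w, -, hw⟩ := exists_eq_lambdaMax hS
  have h0 : 0 ≤ lambdaMax S := hw ▸ hS0 w
  obtain ⟨v, hv, hv'⟩ := exists_eq_lambdaMin hS
  obtain ⟨u, hu, hvu⟩ := hN v hv
  refine ⟨u, hu, ?_⟩
  have h1 := quadForm_add_le hS hS0 (α := 2 / 5) (by norm_num) v (u - v)
  rw [add_sub_cancel, hv'] at h1
  have h2 := le_lambdaMax_mul hS (u - v)
  have hneg : (u - v) ⬝ᵥ (u - v) = (v - u) ⬝ᵥ (v - u) := by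
    rw [← neg_sub v u, neg_dotProduct_neg]
  rw [hneg] at h2
  have h3 := mul_le_mul_of_nonneg_left hvu h0
  have h4 := mul_le_mul_of_nonneg_right hmax (sq_nonneg ε)
  rw [show 1 + (2 / 5 : ℝ) = 7 / 5 by norm_num, show 1 + (2 / 5 : ℝ)⁻¹ = 7 / 2 by norm_num] at h1
  linarith

end Discretization

/-! ### Union bound over the two nets. -/

lemma net_count_bound {d : ℕ} (hd : 0 < d) {R x : ℝ} (hR : 1 ≤ R)
    (hx : (16 * R) ^ d * Real.exp (-x / 8) ≤ 1) :
    (1 + 20 * R) ^ d * Real.exp (-(9 / 64) * x) + 17 ^ d * Real.exp (-(3 / 8) * x) ≤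
      (16 * R) ^ d * Real.exp (-x / 8) := by
  set g := Real.exp (-x / 64) with hg
  have hg0 : 0 < g := Real.exp_pos _
  have e8 : Real.exp (-x / 8) = g ^ 8 := by rw [hg, ← Real.exp_nat_mul]; congr 1; push_cast; ring
  have e9 : Real.exp (-(9 / 64) * x) = g ^ 8 * g := by
    rw [← pow_succ, hg, ← Real.exp_nat_mul]; congr 1; push_cast; ring
  have e24 : Real.exp (-(3 / 8) * x) = g ^ 8 * (g ^ 8) ^ 2 := by
    rw [← pow_mul, ← pow_add, hg, ← Real.exp_nat_mul]; congr 1; push_cast; ring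
  have h16 : (16 : ℝ) ^ d * g ^ 8 ≤ 1 := by
    rw [e8] at hx
    refine le_trans (mul_le_mul_of_nonneg_right ?_ (by positivity)) hx
    exact pow_le_pow_left₀ (by norm_num) (by linarith) d
  have h17 : (17 : ℝ) ^ d * (g ^ 8) ^ 2 ≤ 1 := by
    calc (17 : ℝ) ^ d * (g ^ 8) ^ 2 ≤ 256 ^ d * (g ^ 8) ^ 2 :=
          mul_le_mul_of_nonneg_right (pow_le_pow_left₀ (by norm_num) (by norm_num) d)
            (by positivity)
      _ = (16 ^ d * g ^ 8) ^ 2 := by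
          rw [mul_pow, show (256 : ℝ) = 16 ^ 2 by norm_num, ← pow_mul, ← pow_mul 16 d, mul_comm d 2]
      _ ≤ 1 := pow_le_one₀ (by positivity) h16
  -- The surplus 9/64 - 1/8 = 1/64 is the factor g. Since (7/5)^8 ≤ 16, it pays for replacing 1 +
  -- 20R ≤ 21R = (7/5)·15R by 15R.
  have h57 : (7 / 5 : ℝ) ^ d * g ≤ 1 := by
    rw [← pow_le_one_iff_of_nonneg (n := 8) (by positivity) (by norm_num)]
    refine le_trans ?_ h16
    rw [mul_pow, ← pow_mul, mul_comm d 8, pow_mul]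
    exact mul_le_mul_of_nonneg_right (pow_le_pow_left₀ (by norm_num) (by norm_num) d)
      (by positivity)
  have h15 : (1 + 20 * R) ^ d * g ≤ (15 * R) ^ d := by
    calc (1 + 20 * R) ^ d * g ≤ (15 * R * (7 / 5)) ^ d * g :=
          mul_le_mul_of_nonneg_right (pow_le_pow_left₀ (by linarith) (by linarith) d) hg0.le
      _ = (15 * R) ^ d * ((7 / 5) ^ d * g) := by rw [mul_pow _ (7 / 5 : ℝ)]; ring
      _ ≤ _ := mul_le_of_le_one_right (by positivity) h57
  -- The room between 15R and 16R, with R ≥ 1, absorbs the whole contribution of the coarse net.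
  have hsum : (15 * R) ^ d + 1 ≤ (16 * R) ^ d := by
    calc (15 * R) ^ d + 1 ≤ (15 * R) ^ d + R ^ d := by gcongr; exact one_le_pow₀ hR
      _ ≤ (15 * R + R) ^ d := pow_add_pow_le (by linarith) (by linarith) hd.ne'
      _ = _ := by ring
  rw [e8, e9, e24]
  calc (1 + 20 * R) ^ d * (g ^ 8 * g) + 17 ^ d * (g ^ 8 * (g ^ 8) ^ 2)
      = ((1 + 20 * R) ^ d * g + 17 ^ d * (g ^ 8) ^ 2) * g ^ 8 := by ring
    _ ≤ (16 * R) ^ d * g ^ 8 := mul_le_mul_of_nonneg_right (by linarith) (by positivity)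

variable {T k d p d' : ℕ}

/-- The bound for the smallest eigenvalue of the empirical covariance, on the canonical space. -/
lemma measure_lambdaMin_le (hk : 0 < k) (hkT : k ∣ T) (hd : 0 < d) (hd' : 0 < d')
    (L : Matrix (Fin T × Fin d) (Fin T × Fin p) ℝ)
    (hL : ∀ i j : Fin (T / k), i < j → block k L i j = 0)
    (hpos : 0 < lambdaMin (energyMatrix (blockDiagPart k L))) {q R : ℝ}
    (hq : q = 1 + psi k d' L * T * lambdaMax (L * Lᵀ) / lambdaMin (energyMatrix L))
    (hR : R = √q * √(lambdaMax (energyMatrix L) / lambdaMin (energyMatrix (blockDiagPart k L)))) :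
    (gaussianPi (Fin T × Fin p)).real {w | lambdaMin
        (∑ t, Matrix.vecMulVec (fun i => (L *ᵥ w) (t, i)) (fun i => (L *ᵥ w) (t, i))) ≤
          lambdaMin (energyMatrix (blockDiagPart k L)) / 8} ≤
      (16 * R) ^ d * Real.exp (-(psi k d' L * T) / 8) := by
  have : Nonempty (Fin d) := ⟨⟨0, hd⟩⟩
  have hT : 0 < T := by
    rcases Nat.eq_zero_or_pos T with rfl | h
    · obtain ⟨v, hv, hv'⟩ := exists_eq_lambdaMin (isHermitian_energyMatrix (blockDiagPart k L))
      rw [← hv', dotProduct_energyMatrix_mulVec] at hpos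
      simp at hpos
    · exact h
  set x := psi k d' L * T with hx
  have hx0 : 0 ≤ x := mul_nonneg (psi_nonneg k d' L) (Nat.cast_nonneg T)
  set m' := lambdaMin (energyMatrix (blockDiagPart k L)) with hm'
  set m := lambdaMin (energyMatrix L) with hm
  set M := lambdaMax (energyMatrix L) with hM
  set μ := gaussianPi (Fin T × Fin p)
  have hH' := isHermitian_energyMatrix (blockDiagPart k L)
  have hH := isHermitian_energyMatrix L
  have hlow : ∀ u : Fin d → ℝ, u ⬝ᵥ u = 1 → m' ≤ u ⬝ᵥ energyMatrix (blockDiagPart k L) *ᵥ u :=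
    fun u hu => by simpa [hu] using lambdaMin_mul_le hH' u
  obtain ⟨v, hv, hvm⟩ := exists_eq_lambdaMin hH
  have hmm : m' ≤ m :=
    ((hlow v hv).trans (dotProduct_energyMatrix_blockDiagPart_le k L v)).trans_eq hvm
  have hmM : m ≤ M := by
    have := le_lambdaMax_mul hH v
    rwa [hv, hvm, mul_one] at this
  have hm0 : 0 < m := hpos.trans_le hmm
  have hΛ0 : 0 ≤ lambdaMax (L * Lᵀ) := by
    have h1 := projMatrix_transpose_mulVec_sq_le L hv (Pi.single ⟨0, hT⟩ 1)
    have h2 := Finset.sum_nonneg (s := Finset.univ) fun i _ =>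
      mul_self_nonneg (((projMatrix v L)ᵀ *ᵥ (Pi.single ⟨0, hT⟩ 1 : Fin T → ℝ)) i)
    simpa using h2.trans h1
  have hq1 : 1 ≤ q := by
    rw [hq]
    have := div_nonneg (mul_nonneg hx0 hΛ0) hm0.le
    linarith
  have hMm : 1 ≤ M / m' := (one_le_div hpos).2 (hmm.trans hmM)
  have hR1 : 1 ≤ R := by
    rw [hR]
    exact one_le_mul_of_one_le_of_one_le (Real.one_le_sqrt.2 hq1) (Real.one_le_sqrt.2 hMm)
  have hR2 : R ^ 2 = q * (M / m') := by
    rw [hR, mul_pow, Real.sq_sqrt (by linarith), Real.sq_sqrt (by linarith)]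
  rcases le_total 1 ((16 * R) ^ d * Real.exp (-x / 8)) with htriv | hnontriv
  · exact measureReal_le_one.trans htriv
  have hR0 : 0 < R := by linarith
  obtain ⟨N, hNc, hN1, hN⟩ := exists_net d (ε := 1 / (10 * R)) (by positivity)
  obtain ⟨N', hNc', hN1', hN'⟩ := exists_net d (ε := 1 / 8) (by norm_num)
  let E : (Fin d → ℝ) → Set (Fin T × Fin p → ℝ) := fun u =>
    {w | ∑ t, (projMatrix u L *ᵥ w) t ^ 2 ≤ (u ⬝ᵥ energyMatrix (blockDiagPart k L) *ᵥ u) / 4}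
  let F : (Fin d → ℝ) → Set (Fin T × Fin p → ℝ) := fun u =>
    {w | 3 / 2 * q * M < ∑ t, (projMatrix u L *ᵥ w) t ^ 2}
  have hE : ∀ u ∈ N, μ.real (E u) ≤ Real.exp (-(9 / 64) * x) := fun u hu =>
    ENNReal.toReal_le_of_le_ofReal (Real.exp_pos _).le
      (measure_energy_le hk hkT hT hd' L hL (hN1 u hu))
  have hF : ∀ u ∈ N', μ.real (F u) ≤ Real.exp (-(3 / 8) * x) := fun u hu => by
    refine ENNReal.toReal_le_of_le_ofReal (Real.exp_pos _).le
      (measure_le_energy L (hN1' u hu) ?_ hm0 hx0 hmM hq)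
    exact (hpos.trans_le (hlow u (hN1' u hu))).trans_le
      (dotProduct_energyMatrix_blockDiagPart_le k L u)
  have hsub : {w | lambdaMin
      (∑ t, Matrix.vecMulVec (fun i => (L *ᵥ w) (t, i)) (fun i => (L *ᵥ w) (t, i))) ≤ m' / 8} ⊆
      (⋃ u ∈ N, E u) ∪ ⋃ u ∈ N', F u := by
    intro w hw
    rw [Set.mem_ofPred_eq] at hw
    by_contra hcon
    simp only [Set.mem_union, Set.mem_iUnion, not_or, not_exists, E, F, Set.mem_ofPred_eq,
      not_le, not_lt] at hcon
    obtain ⟨hcE, hcF⟩ := hcon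
    set S := ∑ t, Matrix.vecMulVec (fun i => (L *ᵥ w) (t, i)) (fun i => (L *ᵥ w) (t, i)) with hS
    have hquad : ∀ u : Fin d → ℝ, u ⬝ᵥ S *ᵥ u = ∑ t, (projMatrix u L *ᵥ w) t ^ 2 := fun u => by
      rw [hS, dotProduct_sum_vecMulVec]
      simp_rw [projMatrix_mulVec]
    have hSH : S.IsHermitian := by
      rw [Matrix.IsHermitian, Matrix.conjTranspose_eq_transpose_of_trivial, hS,
        Matrix.transpose_sum]
      simp [Matrix.transpose_vecMulVec]
    obtain ⟨u, hu, hle⟩ := exists_net_quadForm_le hSH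
      (fun u => by rw [hquad]; positivity) hN hN' (b := 3 / 2 * q * M)
      (fun u hu => by rw [hquad]; exact hcF u hu)
    have h1 := hcE u hu
    have h2 := hlow u (hN1 u hu)
    rw [hquad] at hle
    -- Since R² = qM/m', the factors q and M cancel. The contradiction is then (7/5)(1/8) + 24/350 <
    -- 1/4, with m' > 0.
    have h3 : 7 / 2 * (64 / 49 * (3 / 2 * q * M)) * (1 / (10 * R)) ^ 2 = 24 / 350 * m' := by
      have hM0 : M ≠ 0 := (hm0.trans_le hmM).ne'
      rw [div_pow, mul_pow, hR2]
      field_simp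
      norm_num
    rw [h3] at hle
    linarith
  calc _ ≤ μ.real ((⋃ u ∈ N, E u) ∪ ⋃ u ∈ N', F u) := measureReal_mono hsub
    _ ≤ μ.real (⋃ u ∈ N, E u) + μ.real (⋃ u ∈ N', F u) := measureReal_union_le _ _
    _ ≤ ∑ u ∈ N, μ.real (E u) + ∑ u ∈ N', μ.real (F u) :=
        add_le_add (measureReal_biUnion_finset_le _ _) (measureReal_biUnion_finset_le _ _)
    _ ≤ N.card • Real.exp (-(9 / 64) * x) + N'.card • Real.exp (-(3 / 8) * x) :=
        add_le_add (Finset.sum_le_card_nsmul _ _ _ hE) (Finset.sum_le_card_nsmul _ _ _ hF)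
    _ ≤ (1 + 20 * R) ^ d * Real.exp (-(9 / 64) * x) + 17 ^ d * Real.exp (-(3 / 8) * x) := by
        rw [nsmul_eq_mul, nsmul_eq_mul]
        have h1 : 1 + 2 / (1 / (10 * R)) = 1 + 20 * R := by field_simp; ring
        have h2 : (1 : ℝ) + 2 / (1 / 8) = 17 := by norm_num
        rw [h1] at hNc
        rw [h2] at hNc'
        gcongr
    _ ≤ _ := net_count_bound hd hR1 hnontriv

end CausalGaussian

end

/-! ### Transfer from the canonical Gaussian space to P. -/

theorem theorem2 {Ω : Type*} [MeasurableSpace Ω] (P : Measure Ω) [IsProbabilityMeasure P]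
    (T k d p d' : ℕ) (hd : 0 < d) (hd' : 0 < d')
    (L : Matrix (Fin T × Fin d) (Fin T × Fin p) ℝ)
    (W : Ω → EuclideanSpace ℝ (Fin T × Fin p))
    (X : Fin T → Ω → Fin d → ℝ)
    (hX : CausalGaussian.IsCausalGaussian P k L W X)
    (hpos : 0 < CausalGaussian.lambdaMin
      (∑ t, CausalGaussian.secondMoment P (CausalGaussian.decoupled k L W t))) :
    P.real {ω |
        CausalGaussian.lambdaMin ((1 / (T : ℝ)) • ∑ t, Matrix.vecMulVec (X t ω) (X t ω)) ≤
          CausalGaussian.lambdaMin ((1 / (8 * (T : ℝ))) •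
            ∑ t, CausalGaussian.secondMoment P (CausalGaussian.decoupled k L W t))} ≤
      (16 *
        √(1 + CausalGaussian.psi k d' L * T *
            CausalGaussian.lambdaMax
              (CausalGaussian.secondMoment P (CausalGaussian.stack X)) /
            CausalGaussian.lambdaMin (∑ t, CausalGaussian.secondMoment P (X t))) *
        √(CausalGaussian.lambdaMax (∑ t, CausalGaussian.secondMoment P (X t)) /
            CausalGaussian.lambdaMin
              (∑ t, CausalGaussian.secondMoment P (CausalGaussian.decoupled k L W t)))) ^ d *
        Real.exp (-(CausalGaussian.psi k d' L * T) / 8) := by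
  open CausalGaussian in
  have : Nonempty (Fin d) := ⟨⟨0, hd⟩⟩
  have hΓ' : ∑ t, secondMoment P (decoupled k L W t) = energyMatrix (blockDiagPart k L) :=
    sum_secondMoment_linearProcess hX.law
  have hΓ : ∑ t, secondMoment P (X t) = energyMatrix L := by
    rw [← sum_secondMoment_linearProcess hX.law]
    exact Finset.sum_congr rfl fun t _ => secondMoment_congr (hX.eq.mono fun ω h => h t)
  have hstack : secondMoment P (stack X) = L * Lᵀ := by
    rw [← secondMoment_linear hX.law L]
    refine secondMoment_congr (hX.eq.mono fun ω h => ?_)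
    ext s
    exact congrFun (h s.1) s.2
  rw [hΓ'] at hpos
  rw [hΓ', hΓ, hstack, mul_assoc 16]
  refine le_trans ?_ (measure_lambdaMin_le hX.pos hX.dvd hd hd' L hX.causal hpos rfl rfl)
  have hT : 0 < T := by
    rcases Nat.eq_zero_or_pos T with rfl | h
    · obtain ⟨v, hv, hv'⟩ := exists_eq_lambdaMin (isHermitian_energyMatrix (blockDiagPart k L))
      rw [← hv', dotProduct_energyMatrix_mulVec] at hpos
      simp at hpos
    · exact h
  have hT' : (0 : ℝ) < T := Nat.cast_pos.2 hT
  set A : Set (Fin T × Fin p → ℝ) := {w | lambdaMin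
    (∑ t, Matrix.vecMulVec (fun i => (L *ᵥ w) (t, i)) (fun i => (L *ᵥ w) (t, i))) ≤
      lambdaMin (energyMatrix (blockDiagPart k L)) / 8} with hA
  have hmap : P.map (fun ω => (W ω).ofLp) = gaussianPi (Fin T × Fin p) := by
    rw [← gaussianPi_eq_map_stdGaussian, ← hX.law.map_eq,
      AEMeasurable.map_map_of_aemeasurable (by fun_prop) hX.law.aemeasurable]
    rfl
  have hmeas : AEMeasurable (fun ω => (W ω).ofLp) P :=
    Measurable.comp_aemeasurable (by fun_prop) hX.law.aemeasurable
  refine ENNReal.toReal_mono (measure_ne_top _ _) ?_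
  rw [← hmap]
  -- The measure of a preimage is at most the image measure for an arbitrary set, so A need not be
  -- shown measurable.
  refine le_trans (measure_mono_ae ?_) (Measure.le_map_apply hmeas A)
  filter_upwards [hX.eq] with ω hω hmem
  have hXω : ∀ t, X t ω = fun i => (L *ᵥ (W ω).ofLp) (t, i) := hω
  change lambdaMin _ ≤ lambdaMin _ at hmem
  have hSH : (∑ t, Matrix.vecMulVec (X t ω) (X t ω)).IsHermitian := by
    rw [Matrix.IsHermitian, Matrix.conjTranspose_eq_transpose_of_trivial, Matrix.transpose_sum]
    simp [Matrix.transpose_vecMulVec]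
  rw [lambdaMin_smul hSH (by positivity), lambdaMin_smul (isHermitian_energyMatrix _)
    (by positivity)] at hmem
  simp_rw [hXω] at hmem
  change lambdaMin _ ≤ _ / 8
  have h := mul_le_mul_of_nonneg_left hmem hT'.le
  rw [← mul_assoc, ← mul_assoc, mul_one_div_cancel hT'.ne', one_mul,
    show (T : ℝ) * (1 / (8 * T)) = 1 / 8 by field_simp] at h
  linarith
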